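/- Let $\mathbb H=\{(\omega,\tau)\in\mathbb R^2:\tau>0\}$ be the upper half plane $SL(2,\mathbb R)/SO(2)$. Let $\mathcal S(\mathbb H)$ be the space of smooth functions $f:\mathbb H\to\mathbb C$ such that $$\sup_{(\omega,\tau)\in\mathbb H}\Big(\frac{\omega^2+(1+\tau)^2}{\tau}\Big)^N\,|(D^\alpha f)(\omega,\tau)|<\infty$$ for all $N\in\mathbb N$ and all partial derivatives $D^\alpha$ of any order. For real $L\neq 0$ and $t\in\mathbb R$ put $$e_{L,t}(\omega,\tau)=e^{-iL\omega}\,\sqrt{\tau}\;K_{it}(|L|\tau),\qquad K_\nu(x)=\int_0^\infty e^{-x\cosh u}\cosh(\nu u)\,du .$$ Each $e_{L,t}$ is a $C^2$ function on $\mathbb H$ with $$-\tau^2(\partial_\tau^2+\partial_\omega^2)\,e_{L,t}=\big(\tfrac14+t^2\big)e_{L,t},\qquad i\,\partial_\omega e_{L,t}=L\,e_{L,t},$$ so that it is a joint eigenfunction of the charge operator and of the Casimir operator, with the Casimir eigenvalue $s(1-s)$, $s=\tfrac12+it$, of the principal continuous series. For every $f\in\mathcal S(\mathbb H)$, $L\ne0$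 and $t\in\mathbb R$ the integral $$\hat f(L,t)=\int_{\mathbb H}\frac{f(\omega,\tau)\,\overline{e_{L,t}(\omega,\tau)}}{\tau^2}\,d\omega\,d\tau$$ converges absolutely, and for every $(\omega,\tau)\in\mathbb H$ $$f(\omega,\tau)=\frac{1}{2\pi^3}\int_{\mathbb R}dL\int_{\mathbb R}dt\;\hat f(L,t)\,e_{L,t}(\omega,\tau)\;t\sinh(\pi t),$$ where the double integral converges absolutely and $dL$, $dt$ denote Lebesgue measure. (Equivalently, the prefactor is $1/\pi^2$ when $dL$ is replaced by the normalized measure $dL/2\pi$.) -/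

import Mathlib

open MeasureTheory Set

/-- The Poincare upper half plane `{ω + iτ : τ > 0}`, in the coordinates `(ω, τ)`. -/
def upperHalf : Set (ℝ × ℝ) := {p | 0 < p.2}

open scoped ContDiff in
/-- The rapidly decreasing functions on the upper half plane: `f` is smooth there, and every
derivative of `f` stays bounded after multiplication by every power of
`(ω² + (1 + τ)²) / τ`. (The values of `f` off the half plane play no role.) -/
def RapidlyDecreasing (f : ℝ × ℝ → ℂ) : Prop :=
  ContDiffOn ℝ ∞ f upperHalf ∧
    ∀ k N : ℕ, ∃ C : ℝ, ∀ p ∈ upperHalf,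
      ((p.1 ^ 2 + (1 + p.2) ^ 2) / p.2) ^ N * ‖iteratedFDeriv ℝ k f p‖ ≤ C

/-- The modified Bessel function of the second kind,
`K_ν(x) = ∫_0^∞ exp (-x cosh u) cosh (ν u) du`, for complex order `ν` and real `x > 0`. -/
noncomputable def besselK (ν : ℂ) (x : ℝ) : ℂ :=
  ∫ u in Ioi (0 : ℝ), Complex.exp (-(x * Real.cosh u : ℝ)) * Complex.cosh (ν * u)

/-- `e_{L,t}(ω, τ) = exp (-i L ω) √τ K_{it}(|L| τ)`; meaningful for `L ≠ 0` and `τ > 0`. -/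
noncomputable def eigenfn (L t : ℝ) (p : ℝ × ℝ) : ℂ :=
  Complex.exp (-Complex.I * L * p.1) * (Real.sqrt p.2 : ℂ) *
    besselK (Complex.I * t) (|L| * p.2)

/-- The integrand of the transform, with respect to `dω dτ`. -/
noncomputable def transformIntegrand (f : ℝ × ℝ → ℂ) (L t : ℝ) (p : ℝ × ℝ) : ℂ :=
  f p * (starRingEnd ℂ) (eigenfn L t p) / (p.2 : ℂ) ^ 2

/-- The transform `f̂(L, t) = ∫_ℍ f(ω, τ) conj (e_{L,t}(ω, τ)) dω dτ / τ²`. -/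
noncomputable def transform (f : ℝ × ℝ → ℂ) (L t : ℝ) : ℂ :=
  ∫ p in upperHalf, transformIntegrand f L t p

/-- The integrand of the inversion formula at the point `p`, with respect to `dL dt`. -/
noncomputable def inversionIntegrand (f : ℝ × ℝ → ℂ) (p : ℝ × ℝ) (L t : ℝ) : ℂ :=
  transform f L t * eigenfn L t p * ((t * Real.sinh (Real.pi * t) : ℝ) : ℂ)

/-! ### Integrals of powers of `cosh`, and `K_{it}` with its derivatives. -/

section

open Filter Topology

/-! The inversion formula is the planar Fourier inversion theorem read along hyperbolas. Put φ =
τ^{-3/2} f, extended by zero below the real axis; the rapid decrease of f makes φ a Schwartz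
function on the plane, and the transform is the integral T(L,t) of φ(ω,τ) e^{iLω} K_{it}(|L|τ).

Write 2 K_{it}(x) = ∫ exp(-x cosh u + itu) du and move the line of integration to height θ < π/2
(`integral_hypKernel`). Inserted in T, this gives a Fourier transform in ω together with a Laplace
transform in τ at |L| cosh(u + iθ). As θ tends to π/2, cosh(u + iθ) tends to i sinh u, and the pair
becomes the planar Fourier transform of φ at (-L, |L| sinh u)/2π. Hence 2 e^{πt/2} T(L,t) is the
one-dimensional Fourier integral in u of B(u) = φ^(-L/2π, |L| sinh u / 2π)
(`exp_mul_besselTransform`).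

For the inversion, integrate t · 2e^{πt/2} T · 2e^{πt/2} K_{it}(x) over t. The factor t turns B into
B'; one-dimensional Fourier inversion at heights θ < π/2, followed by the same limit, gives an
integral of e^{-ix sinh v} B'(-v) (`integral_mul_hyperbolaFourier_mul_bessel_boundary`). Integration
by parts produces cosh v, the Jacobian of s = |L| sinh v / 2π up to a constant, so what remains is
an inverse Fourier integral over the vertical line -L/2π. Since T and K_{it} are even in t,
symmetrisation replaces e^{πt} by sinh(πt) (`integral_besselTransform_mul_bessel`). The integral
over L then completes planar Fourier inversion (`integral_charge_fourier`).

The limits and the absolute convergence rest on two estimates: K_{it}(x) decays like e^{-π|t|/2} up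
to a factor 1+|t| (`exists_abs_besselMoment_le`), and T does so with an additional (1+t^4)^{-1}
(`exists_norm_besselTransform_le`). -/

lemma Real.one_add_sq_le_cosh_rpow (u : ℝ) :
    1 + u ^ 2 ≤ 64 * Real.cosh u ^ (1 / 4 : ℝ) := by
  have h1 : Real.exp |u| / 2 ≤ Real.cosh u := by
    rw [← Real.cosh_abs, Real.cosh_eq]
    linarith [Real.exp_pos (-|u|)]
  have h2 : Real.exp (|u| / 4) / 2 ≤ Real.cosh u ^ (1 / 4 : ℝ) := by
    calc Real.exp (|u| / 4) / 2 ≤ Real.exp (|u| / 4) / 2 ^ (1 / 4 : ℝ) := by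
          gcongr
          exact Real.rpow_le_self_of_one_le (by norm_num) (by norm_num)
      _ = (Real.exp |u| / 2) ^ (1 / 4 : ℝ) := by
          rw [Real.div_rpow (Real.exp_pos _).le (by norm_num), ← Real.exp_mul]
          ring_nf
      _ ≤ _ := by gcongr
  have h3 := Real.quadratic_le_exp_of_nonneg (x := |u| / 4) (by positivity)
  have h4 : (|u|) ^ 2 = u ^ 2 := sq_abs u
  nlinarith [abs_nonneg u]

/-- The exponent 1/4 is used throughout in place of the logarithmic singularity of K at 0. Any
positive exponent makes the power of `cosh` integrable; it must stay below 1/2 because its square is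
later integrated in L near 0. -/
lemma Real.exp_neg_le_rpow {y : ℝ} (hy : 0 < y) : Real.exp (-y) ≤ y ^ (-(1 / 4) : ℝ) := by
  rw [Real.exp_neg, Real.rpow_neg hy.le]
  gcongr
  rcases le_total y 1 with h | h
  · exact (Real.rpow_le_one hy.le h (by norm_num)).trans (Real.one_le_exp hy.le)
  · exact (Real.rpow_le_self_of_one_le h (by norm_num)).trans
      ((by linarith : y ≤ y + 1).trans (Real.add_one_le_exp y))

lemma integrable_cosh_rpow : Integrable fun u : ℝ => Real.cosh u ^ (-(1 / 4) : ℝ) := by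
  refine (integrable_inv_one_add_sq.const_mul 64).mono' ?_ ?_
  · exact (Real.continuous_cosh.rpow_const
      (fun u => Or.inl (Real.cosh_pos u).ne')).aestronglyMeasurable
  · refine Eventually.of_forall fun u => ?_
    have hp : 0 < Real.cosh u ^ (1 / 4 : ℝ) := Real.rpow_pos_of_pos (Real.cosh_pos u) _
    rw [Real.norm_of_nonneg (Real.rpow_nonneg (Real.cosh_pos u).le _),
      Real.rpow_neg (Real.cosh_pos u).le, ← div_eq_mul_inv, le_div_iff₀ (by positivity),
      inv_mul_le_iff₀ hp]
    linarith [Real.one_add_sq_le_cosh_rpow u]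

lemma integrable_inv_cosh : Integrable fun u : ℝ => (Real.cosh u)⁻¹ := by
  refine integrable_cosh_rpow.mono' ?_ ?_
  · exact (Real.continuous_cosh.inv₀ fun u => (Real.cosh_pos u).ne').aestronglyMeasurable
  · refine Eventually.of_forall fun u => ?_
    rw [Real.norm_of_nonneg (by positivity), ← Real.rpow_neg_one]
    exact Real.rpow_le_rpow_of_exponent_le (Real.one_le_cosh u) (by norm_num)

lemma cosh_pow_mul_exp_le (n : ℕ) {c : ℝ} (hc : 0 < c) (u : ℝ) :
    Real.cosh u ^ n * Real.exp (-(c * Real.cosh u)) ≤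
      (n + 1).factorial / c ^ (n + 1) * (Real.cosh u)⁻¹ := by
  have hu := Real.cosh_pos u
  have h := Real.pow_div_factorial_le_exp _ (mul_pos hc hu).le (n + 1)
  rw [Real.exp_neg, ← div_eq_mul_inv, ← div_eq_mul_inv, div_le_div_iff₀ (Real.exp_pos _) hu,
    div_mul_eq_mul_div, le_div_iff₀ (by positivity)]
  rw [div_le_iff₀ (by positivity)] at h
  calc _ = (c * Real.cosh u) ^ (n + 1) := by ring
    _ ≤ _ := by linarith

lemma integrable_cosh_pow_mul_exp (n : ℕ) {c : ℝ} (hc : 0 < c) :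
    Integrable fun u : ℝ => Real.cosh u ^ n * Real.exp (-(c * Real.cosh u)) := by
  refine (integrable_inv_cosh.const_mul ((n + 1).factorial / c ^ (n + 1))).mono' ?_ ?_
  · exact Continuous.aestronglyMeasurable (by fun_prop)
  · refine Eventually.of_forall fun u => ?_
    rw [Real.norm_of_nonneg (by positivity)]
    exact cosh_pow_mul_exp_le n hc u

/-- The moments `∫_0^∞ (cosh u)^n exp (-x cosh u) cos (t u) du`; up to sign, the `n`-th derivative
of `K_{it}`. -/
noncomputable def besselMoment (t : ℝ) (n : ℕ) (x : ℝ) : ℝ :=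
  ∫ u in Ioi (0 : ℝ), Real.cosh u ^ n * Real.exp (-(x * Real.cosh u)) * Real.cos (t * u)

lemma besselK_eq_besselMoment (t x : ℝ) :
    besselK (Complex.I * t) x = (besselMoment t 0 x : ℂ) := by
  unfold besselK besselMoment
  rw [← integral_complex_ofReal]
  congr 1 with u
  push_cast
  rw [← Complex.cosh_mul_I, pow_zero, one_mul, mul_comm Complex.I, mul_right_comm]

lemma integrable_besselMoment (t : ℝ) (n : ℕ) {x : ℝ} (hx : 0 < x) :
    Integrable fun u : ℝ =>
      Real.cosh u ^ n * Real.exp (-(x * Real.cosh u)) * Real.cos (t * u) := by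
  refine (integrable_cosh_pow_mul_exp n hx).mono' (by fun_prop) ?_
  refine Eventually.of_forall fun u => ?_
  rw [norm_mul, Real.norm_of_nonneg (by positivity : 0 ≤ Real.cosh u ^ n * _)]
  exact mul_le_of_le_one_right (by positivity) (Real.abs_cos_le_one _)

lemma hasDerivAt_besselMoment (t : ℝ) (n : ℕ) {x : ℝ} (hx : 0 < x) :
    HasDerivAt (besselMoment t n) (-besselMoment t (n + 1) x) x := by
  have key := hasDerivAt_integral_of_dominated_loc_of_deriv_le (μ := volume.restrict (Ioi 0))
    (s := Ioi (x / 2)) (x₀ := x)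
    (F := fun x u => Real.cosh u ^ n * Real.exp (-(x * Real.cosh u)) * Real.cos (t * u))
    (F' := fun x u => -(Real.cosh u ^ (n + 1) * Real.exp (-(x * Real.cosh u)) * Real.cos (t * u)))
    (bound := fun u => Real.cosh u ^ (n + 1) * Real.exp (-(x / 2 * Real.cosh u)))
    (Ioi_mem_nhds (by linarith)) (Eventually.of_forall fun y => by fun_prop)
    (integrable_besselMoment t n hx).integrableOn (by fun_prop) ?_
    (integrable_cosh_pow_mul_exp (n + 1) (by linarith)).integrableOn ?_
  · have := key.2
    rwa [integral_neg] at this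
  · refine Eventually.of_forall fun u y hy => ?_
    rw [norm_neg, norm_mul, Real.norm_of_nonneg (by positivity : 0 ≤ Real.cosh u ^ (n + 1) * _)]
    refine (mul_le_of_le_one_right (by positivity) (Real.abs_cos_le_one _)).trans ?_
    have : x / 2 < y := hy
    gcongr
  · refine Eventually.of_forall fun u y _ => ?_
    have h := (((hasDerivAt_id y).mul_const (Real.cosh u)).neg.exp.const_mul
      (Real.cosh u ^ n)).mul_const (Real.cos (t * u))
    refine h.congr_deriv ?_
    simp only [id, Pi.neg_apply]
    ring

lemma contDiffOn_besselMoment (t : ℝ) (m n : ℕ) :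
    ContDiffOn ℝ m (besselMoment t n) (Ioi 0) := by
  induction m generalizing n with
  | zero =>
    rw [Nat.cast_zero, contDiffOn_zero]
    exact fun x hx => (hasDerivAt_besselMoment t n hx).continuousAt.continuousWithinAt
  | succ m ih =>
    push_cast
    rw [contDiffOn_succ_iff_deriv_of_isOpen isOpen_Ioi]
    refine ⟨fun x hx =>
      (hasDerivAt_besselMoment t n hx).differentiableAt.differentiableWithinAt, by simp, ?_⟩
    exact (ih (n + 1)).neg.congr fun x hx => (hasDerivAt_besselMoment t n hx).deriv

/-- The modified Bessel equation for `K_{it}`. -/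
lemma besselMoment_ode (t : ℝ) {x : ℝ} (hx : 0 < x) :
    x ^ 2 * besselMoment t 2 x - x * besselMoment t 1 x =
      (x ^ 2 - t ^ 2) * besselMoment t 0 x := by
  let E : ℝ → ℝ := fun u => Real.exp (-(x * Real.cosh u))
  -- The Bessel equation is the fundamental theorem of calculus for `G`: its derivative is the
  -- combination of the three integrands, and it vanishes both at 0 and at infinity.
  let G : ℝ → ℝ := fun u =>
    -(x * Real.sinh u * E u * Real.cos (t * u)) + t * (E u * Real.sin (t * u))
  have hE : ∀ u, HasDerivAt E (E u * -(x * Real.sinh u)) u := fun u =>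
    ((Real.hasDerivAt_cosh u).const_mul x).neg.exp
  have htu : ∀ u, HasDerivAt (fun u => t * u) t u := fun u => by
    simpa using (hasDerivAt_id u).const_mul t
  have hG : ∀ u, HasDerivAt G
      (x ^ 2 * (Real.cosh u ^ 2 * E u * Real.cos (t * u))
        - x * (Real.cosh u ^ 1 * E u * Real.cos (t * u))
        - (x ^ 2 - t ^ 2) * (Real.cosh u ^ 0 * E u * Real.cos (t * u))) u := fun u => by
    refine ((((Real.hasDerivAt_sinh u).const_mul x).mul (hE u)).mul (htu u).cos).neg.add
      (((hE u).mul (htu u).sin).const_mul t) |>.congr_deriv ?_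
    simp only [Pi.mul_apply]
    rw [Real.cosh_sq u]
    ring
  have hI := fun n => (integrable_besselMoment t n hx)
  have hdec : Tendsto (fun u => Real.cosh u * E u) atTop (𝓝 0) := by
    have h1 : Tendsto (fun y : ℝ => y * Real.exp (-(x * y))) atTop (𝓝 0) := by
      have := Real.tendsto_pow_mul_exp_neg_atTop_nhds_zero 1
      have h2 := (this.comp (tendsto_id.const_mul_atTop hx)).const_mul x⁻¹
      simp only [mul_zero] at h2
      refine h2.congr fun y => ?_
      simp only [Function.comp, id, pow_one]
      field_simp
    refine h1.comp ?_
    refine tendsto_atTop_mono (fun u => ?_) (Real.tendsto_exp_atTop.atTop_div_const two_pos)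
    rw [Real.cosh_eq]; linarith [Real.exp_pos (-u)]
  have hlim : Tendsto G atTop (𝓝 0) := by
    have h0 : Tendsto (fun u => (x + |t|) * (Real.cosh u * E u)) atTop (𝓝 0) := by
      simpa using hdec.const_mul (x + |t|)
    refine squeeze_zero_norm (fun u => ?_) h0
    have e := (Real.exp_pos (-(x * Real.cosh u))).le
    have hs : |Real.sinh u| ≤ Real.cosh u := by
      rw [Real.abs_sinh, ← Real.cosh_abs]; exact (Real.sinh_lt_cosh _).le
    have h1 : ‖-(x * Real.sinh u * E u * Real.cos (t * u))‖ ≤ x * Real.cosh u * E u * 1 := by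
      rw [norm_neg, norm_mul, norm_mul, norm_mul, Real.norm_of_nonneg hx.le,
        Real.norm_of_nonneg (show 0 ≤ E u from e)]
      gcongr
      · exact hs
      · exact Real.abs_cos_le_one _
    have h2 : ‖t * (E u * Real.sin (t * u))‖ ≤ |t| * (E u * 1) := by
      rw [norm_mul, norm_mul, Real.norm_of_nonneg (show 0 ≤ E u from e)]
      gcongr
      · exact le_of_eq (Real.norm_eq_abs t)
      · exact Real.abs_sin_le_one _
    have h3 : |t| * E u ≤ |t| * (Real.cosh u * E u) := by
      gcongr
      exact le_mul_of_one_le_left e (Real.one_le_cosh u)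
    refine (norm_add_le _ _).trans ?_
    linarith
  have hint := ((((hI 2).const_mul (x ^ 2)).sub ((hI 1).const_mul x)).sub
    ((hI 0).const_mul (x ^ 2 - t ^ 2))).integrableOn (s := Ioi 0)
  have key := integral_Ioi_of_hasDerivAt_of_tendsto (a := 0) (m := 0)
    (hG 0).continuousAt.continuousWithinAt (fun u _ => hG u) hint hlim
  have h0 : G 0 = 0 := by simp [G]
  rw [h0, integral_sub, integral_sub, integral_const_mul, integral_const_mul,
    integral_const_mul] at key
  · unfold besselMoment
    linarith
  · exact ((hI 2).const_mul _).integrableOn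
  · exact ((hI 1).const_mul _).integrableOn
  · exact (((hI 2).const_mul (x ^ 2)).sub ((hI 1).const_mul x)).integrableOn
  · exact ((hI 0).const_mul _).integrableOn

lemma besselMoment_neg (t : ℝ) (n : ℕ) (x : ℝ) : besselMoment (-t) n x = besselMoment t n x := by
  simp [besselMoment]

end

/-! ### Contour shift and exponential decay of `K_{it}` in t. -/

section

open Filter Topology

/-- The entire function `exp (-x cosh z + i t z)`, whose integral over `ℝ` is `2 K_{it}(x)`. -/
noncomputable def hypKernel (x t : ℝ) (z : ℂ) : ℂ :=
  Complex.exp (-(x * Complex.cosh z) + Complex.I * t * z)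

lemma continuous_hypKernel (x t : ℝ) : Continuous (hypKernel x t) := by
  unfold hypKernel
  fun_prop

lemma re_cosh_add_mul_I (u θ : ℝ) :
    (Complex.cosh (u + θ * Complex.I)).re = Real.cosh u * Real.cos θ := by
  rw [Complex.cosh_add, Complex.cosh_mul_I, Complex.sinh_mul_I, ← Complex.ofReal_cosh,
    ← Complex.ofReal_sinh, ← Complex.ofReal_cos, ← Complex.ofReal_sin]
  simp [Complex.cos_ofReal_re, Complex.sin_ofReal_re, Complex.sinh_ofReal_re,
    Complex.cosh_ofReal_re]

lemma im_cosh_add_mul_I (u θ : ℝ) :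
    (Complex.cosh (u + θ * Complex.I)).im = Real.sinh u * Real.sin θ := by
  rw [Complex.cosh_add, Complex.cosh_mul_I, Complex.sinh_mul_I, ← Complex.ofReal_cosh,
    ← Complex.ofReal_sinh, ← Complex.ofReal_cos, ← Complex.ofReal_sin]
  simp [Complex.cos_ofReal_re, Complex.sin_ofReal_re, Complex.sinh_ofReal_re,
    Complex.cosh_ofReal_re]

lemma norm_hypKernel (x t u θ : ℝ) :
    ‖hypKernel x t (u + θ * Complex.I)‖ =
      Real.exp (-(x * Real.cos θ * Real.cosh u)) * Real.exp (-(θ * t)) := by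
  rw [hypKernel, Complex.norm_exp, ← Real.exp_add, Complex.add_re, Complex.neg_re,
    Complex.re_ofReal_mul, re_cosh_add_mul_I]
  congr 1
  simp
  ring

lemma norm_sinh_le (z : ℂ) : ‖Complex.sinh z‖ ≤ Real.cosh z.re := by
  rw [Complex.sinh, Real.cosh_eq, norm_div, Complex.norm_ofNat]
  gcongr
  refine (norm_sub_le _ _).trans ?_
  rw [Complex.norm_exp, Complex.norm_exp, Complex.neg_re]

lemma hasDerivAt_hypKernel (x t : ℝ) (z : ℂ) :
    HasDerivAt (hypKernel x t)
      (hypKernel x t z * (-(x * Complex.sinh z) + Complex.I * t)) z := by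
  unfold hypKernel
  refine HasDerivAt.cexp ?_
  refine ((Complex.hasDerivAt_cosh z).const_mul (x : ℂ)).neg.add ?_
  simpa using (hasDerivAt_id z).const_mul (Complex.I * t)

lemma integrable_hypKernel {x : ℝ} (hx : 0 < x) (t : ℝ) {θ : ℝ} (hθ : |θ| < Real.pi / 2) :
    Integrable fun u : ℝ => hypKernel x t (u + θ * Complex.I) := by
  have hc := Real.cos_pos_of_mem_Ioo (abs_lt.1 hθ)
  refine ((integrable_cosh_pow_mul_exp 0 (mul_pos hx hc)).mul_const
    (Real.exp (-(θ * t)))).mono' ?_ ?_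
  · exact ((continuous_hypKernel x t).comp (by fun_prop)).aestronglyMeasurable
  · refine Eventually.of_forall fun u => ?_
    rw [norm_hypKernel]
    simp

lemma integral_hypKernel_zero {x : ℝ} (hx : 0 < x) (t : ℝ) :
    ∫ u : ℝ, hypKernel x t u = 2 * (besselMoment t 0 x : ℂ) := by
  have hi : Integrable fun u : ℝ => hypKernel x t u := by
    simpa using integrable_hypKernel hx t (θ := 0) (by simp [Real.pi_pos])
  rw [← intervalIntegral.integral_Iic_add_Ioi (b := 0) hi.integrableOn hi.integrableOn]
  have h1 : ∫ u in Iic (0 : ℝ), hypKernel x t u = ∫ u in Ioi (0 : ℝ), hypKernel x t (-u) := by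
    have := integral_comp_neg_Ioi 0 (fun u : ℝ => hypKernel x t u)
    simpa using this.symm
  have hi' : Integrable fun u : ℝ => hypKernel x t (-u) := by
    simpa using hi.comp_neg
  rw [h1, ← integral_add hi'.integrableOn hi.integrableOn, besselMoment,
    ← integral_complex_ofReal, ← integral_const_mul]
  congr 1 with u
  simp only [hypKernel, Complex.exp_add, Complex.cosh_neg]
  push_cast
  rw [Complex.cos]
  ring_nf

/-- `K_{it}` as an integral over a shifted horizontal line. -/
lemma integral_hypKernel {x : ℝ} (hx : 0 < x) (t : ℝ) {θ : ℝ} (hθ : |θ| < Real.pi / 2) :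
    ∫ u : ℝ, hypKernel x t (u + θ * Complex.I) = 2 * (besselMoment t 0 x : ℂ) := by
  -- In place of Cauchy's theorem on rectangles: the kernel is holomorphic, so its θ-derivative is i
  -- times its u-derivative, and the latter has integral zero over the line.
  have key : ∀ θ₀ : ℝ, |θ₀| < Real.pi / 2 →
      HasDerivAt (fun θ : ℝ => ∫ u : ℝ, hypKernel x t (u + θ * Complex.I)) 0 θ₀ := by
    intro θ₀ h₀
    obtain ⟨r, hr₀, hr⟩ := exists_between h₀
    have hrpos : 0 < r := (abs_nonneg _).trans_lt hr₀
    have hc : 0 < Real.cos r := Real.cos_pos_of_mem_Ioo ⟨by linarith, hr⟩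
    have hd := hasDerivAt_integral_of_dominated_loc_of_deriv_le (μ := (volume : Measure ℝ))
      (s := Ioo (-r) r) (x₀ := θ₀)
      (F := fun (θ : ℝ) (u : ℝ) => hypKernel x t (u + θ * Complex.I))
      (F' := fun (θ : ℝ) (u : ℝ) => Complex.I * (hypKernel x t (u + θ * Complex.I) *
        (-(x * Complex.sinh (u + θ * Complex.I)) + Complex.I * t)))
      (bound := fun u => Real.exp (r * |t|) *
        (x * (Real.cosh u ^ 1 * Real.exp (-(x * Real.cos r * Real.cosh u)))
          + |t| * (Real.cosh u ^ 0 * Real.exp (-(x * Real.cos r * Real.cosh u)))))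
      (Ioo_mem_nhds (abs_lt.1 hr₀).1 (abs_lt.1 hr₀).2)
      (Eventually.of_forall fun y =>
        ((continuous_hypKernel x t).comp (by fun_prop)).aestronglyMeasurable)
      (integrable_hypKernel hx t h₀)
      (Continuous.aestronglyMeasurable (continuous_const.mul
        (((continuous_hypKernel x t).comp (by fun_prop)).mul (by fun_prop)))) ?_
      ((((integrable_cosh_pow_mul_exp 1 (mul_pos hx hc)).const_mul x).add
        ((integrable_cosh_pow_mul_exp 0 (mul_pos hx hc)).const_mul |t|)).const_mul _) ?_
    · refine hd.2.congr_deriv ?_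
      have hz : ∀ u : ℝ, HasDerivAt (fun u : ℝ => hypKernel x t (u + θ₀ * Complex.I))
          (hypKernel x t (u + θ₀ * Complex.I) *
            (-(x * Complex.sinh (u + θ₀ * Complex.I)) + Complex.I * t)) u := fun u => by
        have h1 : HasDerivAt (fun u : ℝ => (u : ℂ) + θ₀ * Complex.I) 1 u :=
          (Complex.ofRealCLM.hasDerivAt).add_const _
        have h2 := (hasDerivAt_hypKernel x t _).comp u h1
        rw [mul_one] at h2
        exact h2
      rw [integral_const_mul, integral_eq_zero_of_hasDerivAt_of_integrable hz ?_
        (integrable_hypKernel hx t h₀), mul_zero]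
      have := hd.1.const_mul (-Complex.I)
      refine this.congr (Eventually.of_forall fun u => ?_)
      simp only
      rw [← mul_assoc, neg_mul, Complex.I_mul_I, neg_neg, one_mul]
    · refine Eventually.of_forall fun u θ hθ => ?_
      have hcos : Real.cos r ≤ Real.cos θ := by
        rw [← Real.cos_abs θ]
        exact Real.cos_le_cos_of_nonneg_of_le_pi (abs_nonneg _) (by linarith [Real.pi_pos])
          (abs_lt.2 hθ).le
      have ht : -(θ * t) ≤ r * |t| := by
        rw [← neg_mul]
        refine (le_abs_self _).trans ?_
        rw [abs_mul, abs_neg]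
        gcongr
        exact (abs_lt.2 hθ).le
      rw [norm_mul, Complex.norm_I, one_mul, norm_mul, norm_hypKernel]
      have h1 : ‖-((x : ℂ) * Complex.sinh (u + θ * Complex.I)) + Complex.I * t‖ ≤
          x * Real.cosh u + |t| := by
        refine (norm_add_le _ _).trans ?_
        rw [norm_neg, norm_mul, norm_mul, Complex.norm_I, one_mul, Complex.norm_real,
          Complex.norm_real, Real.norm_of_nonneg hx.le, Real.norm_eq_abs]
        gcongr
        simpa using norm_sinh_le (u + θ * Complex.I)
      have h2 : Real.exp (-(x * Real.cos θ * Real.cosh u)) ≤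
          Real.exp (-(x * Real.cos r * Real.cosh u)) := by gcongr
      calc _ ≤ Real.exp (-(x * Real.cos r * Real.cosh u)) * Real.exp (r * |t|) *
            (x * Real.cosh u + |t|) := by gcongr
        _ = _ := by ring
    · refine Eventually.of_forall fun u θ _ => ?_
      have h1 : HasDerivAt (fun θ : ℝ => (u : ℂ) + θ * Complex.I) (1 * Complex.I) θ :=
        ((Complex.ofRealCLM.hasDerivAt).mul_const _).const_add _
      refine ((hasDerivAt_hypKernel x t _).scomp θ h1).congr_deriv ?_
      simp
  have hc := isOpen_Ioo.is_const_of_deriv_eq_zero (isPreconnected_Ioo)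
    (fun θ₀ h₀ => (key θ₀ (abs_lt.2 h₀)).differentiableAt.differentiableWithinAt)
    (fun θ₀ h₀ => (key θ₀ (abs_lt.2 h₀)).deriv) (abs_lt.1 hθ)
    (⟨by linarith [Real.pi_pos], by linarith [Real.pi_pos]⟩ :
      (0 : ℝ) ∈ Ioo (-(Real.pi / 2)) (Real.pi / 2))
  rw [hc, ← integral_hypKernel_zero hx t]
  simp

lemma exp_neg_mul_cosh_le {a : ℝ} (ha : 0 < a) (u : ℝ) :
    Real.exp (-(a * Real.cosh u)) ≤ a ^ (-(1 / 4) : ℝ) * Real.cosh u ^ (-(1 / 4) : ℝ) := by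
  rw [← Real.mul_rpow ha.le (Real.cosh_pos u).le]
  exact Real.exp_neg_le_rpow (mul_pos ha (Real.cosh_pos u))

/-- Uniform exponential decay of `K_{it}(x)` in `t`. -/
lemma exists_abs_besselMoment_le : ∃ C : ℝ, 0 ≤ C ∧ ∀ t x : ℝ, 0 < x →
    |besselMoment t 0 x| ≤
      C * (1 + |t|) * x ^ (-(1 / 4) : ℝ) * Real.exp (-(Real.pi / 2 * |t|)) := by
  set A : ℝ := ∫ u : ℝ, Real.cosh u ^ (-(1 / 4) : ℝ) with hA
  have hA0 : 0 ≤ A := integral_nonneg fun u => Real.rpow_nonneg (Real.cosh_pos u).le _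
  refine ⟨Real.exp 1 * A, by positivity, fun t x hx => ?_⟩
  wlog ht : 0 ≤ t generalizing t
  · have := this (-t) (by linarith)
    rwa [besselMoment_neg, abs_neg] at this
  rw [abs_of_nonneg ht]
  -- The height π/2 - δ balances two effects: δt ≤ 1 keeps the exponential within a factor e of
  -- e^{-πt/2}, while cos θ ≥ δ/2 costs only a power of 1 + t.
  set δ : ℝ := 1 / (1 + t) with hδ
  have hδ0 : 0 < δ := by positivity
  have hδ1 : δ ≤ 1 := by rw [hδ, div_le_one (by positivity)]; linarith
  have hpi := Real.pi_gt_three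
  have hpi4 := Real.pi_le_four
  set θ : ℝ := Real.pi / 2 - δ with hθ
  have hθlt : |θ| < Real.pi / 2 := by rw [abs_lt]; constructor <;> linarith
  have hcos : δ / 2 ≤ Real.cos θ := by
    rw [hθ, Real.cos_pi_div_two_sub]
    refine le_trans ?_ (Real.mul_le_sin hδ0.le (by linarith))
    have : 1 / 2 ≤ 2 / Real.pi := by rw [div_le_div_iff₀ two_pos Real.pi_pos]; linarith
    nlinarith
  have hK := integral_hypKernel hx t hθlt
  have hK' : 2 * |besselMoment t 0 x| ≤
      ((x * (δ / 2)) ^ (-(1 / 4) : ℝ) * Real.exp (-(θ * t))) * A := by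
    calc 2 * |besselMoment t 0 x| = ‖∫ u : ℝ, hypKernel x t (u + θ * Complex.I)‖ := by
          rw [hK, norm_mul, Complex.norm_real]; simp
      _ ≤ ∫ u : ℝ, ((x * (δ / 2)) ^ (-(1 / 4) : ℝ) * Real.exp (-(θ * t))) *
            Real.cosh u ^ (-(1 / 4) : ℝ) := by
          refine norm_integral_le_of_norm_le (integrable_cosh_rpow.const_mul _)
            (Eventually.of_forall fun u => ?_)
          rw [norm_hypKernel, mul_right_comm _ _ (Real.cosh u ^ (-(1 / 4) : ℝ))]
          gcongr
          refine le_trans ?_ (exp_neg_mul_cosh_le (mul_pos hx (half_pos hδ0)) u)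
          gcongr
      _ = _ := by rw [integral_const_mul]
  have h1 : (x * (δ / 2)) ^ (-(1 / 4) : ℝ) ≤ 2 * (1 + t) * x ^ (-(1 / 4) : ℝ) := by
    rw [Real.mul_rpow hx.le (by positivity), mul_comm]
    gcongr
    rw [Real.rpow_neg (by positivity), ← Real.inv_rpow (by positivity)]
    have : (δ / 2)⁻¹ = 2 * (1 + t) := by rw [hδ]; field_simp
    rw [this]
    exact Real.rpow_le_self_of_one_le (by linarith) (by norm_num)
  have h2 : Real.exp (-(θ * t)) ≤ Real.exp 1 * Real.exp (-(Real.pi / 2 * t)) := by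
    rw [← Real.exp_add]
    gcongr
    have : δ * t ≤ 1 := by rw [hδ, one_div, inv_mul_le_iff₀ (by positivity)]; linarith
    rw [hθ]; linarith
  have h3 : 0 ≤ 2 * (1 + t) * x ^ (-(1 / 4) : ℝ) := by positivity
  have : ((x * (δ / 2)) ^ (-(1 / 4) : ℝ) * Real.exp (-(θ * t))) * A ≤
      ((2 * (1 + t) * x ^ (-(1 / 4) : ℝ)) * (Real.exp 1 * Real.exp (-(Real.pi / 2 * t)))) * A := by
    gcongr
  linarith

end

/-! ### The Casimir and charge eigenvalue equations. -/

section

open Filter Topology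

lemma eigenfn_eq (L t : ℝ) (p : ℝ × ℝ) :
    eigenfn L t p = Complex.exp (-Complex.I * L * p.1) *
      ((Real.sqrt p.2 * besselMoment t 0 (|L| * p.2) : ℝ) : ℂ) := by
  rw [eigenfn, besselK_eq_besselMoment]
  push_cast
  ring

lemma isOpen_upperHalf : IsOpen upperHalf := isOpen_lt continuous_const continuous_snd

lemma contDiffOn_eigenfn {L : ℝ} (hL : L ≠ 0) (t : ℝ) :
    ContDiffOn ℝ 2 (eigenfn L t) upperHalf := by
  have h1 : ContDiffOn ℝ 2 (fun p : ℝ × ℝ => Real.sqrt p.2) upperHalf := fun p hp =>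
    (contDiffAt_snd.sqrt (ne_of_gt hp)).contDiffWithinAt
  have h2 : ContDiffOn ℝ 2 (fun p : ℝ × ℝ => besselMoment t 0 (|L| * p.2)) upperHalf :=
    (contDiffOn_besselMoment t 2 0).comp (contDiff_const.mul contDiff_snd).contDiffOn
      fun p hp => mul_pos (abs_pos.2 hL) hp
  have h3 : ContDiff ℝ 2 (fun p : ℝ × ℝ => Complex.exp (-Complex.I * L * p.1)) := by
    have : ContDiff ℝ 2 (fun p : ℝ × ℝ => (p.1 : ℂ)) :=
      Complex.ofRealCLM.contDiff.comp contDiff_fst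
    fun_prop
  refine (h3.contDiffOn.mul (Complex.ofRealCLM.contDiff.comp_contDiffOn (h1.mul h2))).congr
    fun p _ => ?_
  rw [eigenfn_eq]
  rfl

lemma hasDerivAt_cexp_charge (L x : ℝ) (c : ℂ) :
    HasDerivAt (fun x : ℝ => Complex.exp (-Complex.I * L * x) * c)
      (Complex.exp (-Complex.I * L * x) * (-Complex.I * L * c)) x := by
  have h : HasDerivAt (fun x : ℝ => -Complex.I * L * (x : ℂ)) (-Complex.I * L) x := by
    simpa using (Complex.ofRealCLM.hasDerivAt (x := x)).const_mul (-Complex.I * L)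
  refine (h.cexp.mul_const c).congr_deriv ?_
  ring

lemma charge_eigenfn (L t ω τ : ℝ) :
    Complex.I * deriv (fun x : ℝ => eigenfn L t (x, τ)) ω = L * eigenfn L t (ω, τ) := by
  simp only [eigenfn_eq]
  rw [(hasDerivAt_cexp_charge L ω _).deriv]
  linear_combination (-(L * (Complex.exp (-Complex.I * L * ω) *
    ((Real.sqrt τ * besselMoment t 0 (|L| * τ) : ℝ) : ℂ)))) * Complex.I_mul_I

lemma iteratedDeriv_two_fst_eigenfn (L t ω τ : ℝ) :
    iteratedDeriv 2 (fun x : ℝ => eigenfn L t (x, τ)) ω = -(L : ℂ) ^ 2 * eigenfn L t (ω, τ) := by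
  have h : deriv (fun x : ℝ => eigenfn L t (x, τ)) = fun x : ℝ =>
      Complex.exp (-Complex.I * L * x) * (-Complex.I * L *
        ((Real.sqrt τ * besselMoment t 0 (|L| * τ) : ℝ) : ℂ)) := by
    ext x
    simp only [eigenfn_eq]
    exact (hasDerivAt_cexp_charge L x _).deriv
  rw [iteratedDeriv_succ, iteratedDeriv_one, h, (hasDerivAt_cexp_charge L ω _).deriv, eigenfn_eq]
  linear_combination (Complex.exp (-Complex.I * L * ω) * L ^ 2 *
    ((Real.sqrt τ * besselMoment t 0 (|L| * τ) : ℝ) : ℂ)) * Complex.I_mul_I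

lemma hasDerivAt_besselMoment_mul (t : ℝ) (n : ℕ) {l y : ℝ} (hl : 0 < l) (hy : 0 < y) :
    HasDerivAt (fun y => besselMoment t n (l * y)) (-(l * besselMoment t (n + 1) (l * y))) y := by
  have h := (hasDerivAt_besselMoment t n (mul_pos hl hy)).comp y
    ((hasDerivAt_id y).const_mul l)
  refine h.congr_deriv ?_
  ring

/-- The factor √y absorbs the first-order term of the Bessel equation, and its own second derivative
supplies the 1/4. -/
lemma iteratedDeriv_two_sqrt_mul_bessel (t : ℝ) {l y : ℝ} (hl : 0 < l) (hy : 0 < y) :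
    y ^ 2 * iteratedDeriv 2 (fun y => Real.sqrt y * besselMoment t 0 (l * y)) y =
      (l ^ 2 * y ^ 2 - (1 / 4 + t ^ 2)) * (Real.sqrt y * besselMoment t 0 (l * y)) := by
  have h1 : ∀ z : ℝ, 0 < z →
      HasDerivAt (fun y => Real.sqrt y * besselMoment t 0 (l * y))
        (1 / (2 * Real.sqrt z) * besselMoment t 0 (l * z)
          + Real.sqrt z * -(l * besselMoment t 1 (l * z))) z := fun z hz =>
    (Real.hasDerivAt_sqrt hz.ne').mul (hasDerivAt_besselMoment_mul t 0 hl hz)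
  have h2 : deriv (fun y => Real.sqrt y * besselMoment t 0 (l * y)) =ᶠ[𝓝 y] fun z =>
      (2 * Real.sqrt z)⁻¹ * besselMoment t 0 (l * z)
          + Real.sqrt z * -(l * besselMoment t 1 (l * z)) := by
    filter_upwards [Ioi_mem_nhds hy] with z hz
    rw [(h1 z hz).deriv, one_div]
  have hs : 0 < Real.sqrt y := Real.sqrt_pos.2 hy
  have h3 := (((((Real.hasDerivAt_sqrt hy.ne').const_mul 2).inv (by positivity)).mul
    (hasDerivAt_besselMoment_mul t 0 hl hy)).add ((Real.hasDerivAt_sqrt hy.ne').mul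
      ((hasDerivAt_besselMoment_mul t 1 hl hy).const_mul l).neg))
  have h4 : deriv (fun z => (2 * Real.sqrt z)⁻¹ * besselMoment t 0 (l * z)
          + Real.sqrt z * -(l * besselMoment t 1 (l * z))) y = _ := h3.deriv
  rw [iteratedDeriv_succ, iteratedDeriv_one, h2.deriv_eq, h4]
  have ode := besselMoment_ode t (mul_pos hl hy)
  have hyy : y = Real.sqrt y ^ 2 := (Real.sq_sqrt hy.le).symm
  simp only [Pi.inv_apply, Pi.neg_apply, zero_add, Nat.reduceAdd]
  generalize besselMoment t 0 (l * y) = a at *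
  generalize besselMoment t 1 (l * y) = b at *
  generalize besselMoment t 2 (l * y) = c at *
  generalize Real.sqrt y = s at *
  subst hyy
  field_simp
  linear_combination (16 : ℝ) * ode

lemma casimir_eigenfn {L : ℝ} (hL : L ≠ 0) (t ω : ℝ) {τ : ℝ} (hτ : 0 < τ) :
    -(τ : ℂ) ^ 2 * (iteratedDeriv 2 (fun y : ℝ => eigenfn L t (ω, y)) τ
        + iteratedDeriv 2 (fun x : ℝ => eigenfn L t (x, τ)) ω)
      = (1 / 4 + (t : ℂ) ^ 2) * eigenfn L t (ω, τ) := by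
  have hl := abs_pos.2 hL
  have hR : ContDiffAt ℝ 2 (fun y => Real.sqrt y * besselMoment t 0 (|L| * y)) τ := by
    refine (contDiffAt_id.sqrt hτ.ne').mul ?_
    exact ((contDiffOn_besselMoment t 2 0).contDiffAt (Ioi_mem_nhds (mul_pos hl hτ))).comp τ
      (contDiffAt_const.mul contDiffAt_id)
  have h : iteratedDeriv 2 (fun y : ℝ => eigenfn L t (ω, y)) τ =
      Complex.exp (-Complex.I * L * ω) * ((iteratedDeriv 2
        (fun y => Real.sqrt y * besselMoment t 0 (|L| * y)) τ : ℝ) : ℂ) := by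
    simp only [eigenfn_eq]
    rw [iteratedDeriv_const_mul_field]
    congr 1
    have := Complex.ofRealCLM.iteratedFDeriv_comp_left hR (i := 2) le_rfl
    rw [iteratedDeriv_eq_iteratedFDeriv, iteratedDeriv_eq_iteratedFDeriv]
    exact congrArg (fun M => M fun _ => (1 : ℝ)) this
  have key := congrArg (fun r : ℝ => (r : ℂ)) (iteratedDeriv_two_sqrt_mul_bessel t hl hτ)
  have hLL : ((|L| : ℝ) : ℂ) ^ 2 = (L : ℂ) ^ 2 := by
    rw [← Complex.ofReal_pow, sq_abs, Complex.ofReal_pow]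
  rw [h, iteratedDeriv_two_fst_eigenfn, eigenfn_eq]
  push_cast at key ⊢
  rw [hLL] at key
  linear_combination -Complex.exp (-Complex.I * L * ω) * key

end

/-! ### Rapidly decreasing functions, extended by zero, as Schwartz functions. -/

section

open Filter Topology
open scoped SchwartzMap ContDiff

/-- The single weight controls both ends: powers of |ω| and τ give decay at infinity, powers of 1/τ
give vanishing at the boundary. -/
lemma upperWeight_bounds {p : ℝ × ℝ} (hp : p ∈ upperHalf) :
    p.2 ≤ (p.1 ^ 2 + (1 + p.2) ^ 2) / p.2 ∧ p.2⁻¹ ≤ (p.1 ^ 2 + (1 + p.2) ^ 2) / p.2 ∧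
      |p.1| ≤ (p.1 ^ 2 + (1 + p.2) ^ 2) / p.2 ∧ 1 ≤ (p.1 ^ 2 + (1 + p.2) ^ 2) / p.2 := by
  have h : 0 < p.2 := hp
  have h1 : |p.1| ^ 2 = p.1 ^ 2 := sq_abs _
  refine ⟨?_, ?_, ?_, ?_⟩
  · rw [le_div_iff₀ h]; nlinarith [sq_nonneg p.1]
  · rw [inv_eq_one_div]; gcongr; nlinarith [sq_nonneg p.1]
  · rw [le_div_iff₀ h]; nlinarith [sq_nonneg (|p.1| - p.2)]
  · rw [le_div_iff₀ h]; nlinarith [sq_nonneg p.1, sq_nonneg p.2]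

lemma rpow_le_upperWeight_pow {p : ℝ × ℝ} (hp : p ∈ upperHalf) {s : ℝ} {M : ℕ} (hs : |s| ≤ M) :
    p.2 ^ s ≤ ((p.1 ^ 2 + (1 + p.2) ^ 2) / p.2) ^ M := by
  have h : 0 < p.2 := hp
  obtain ⟨h1, h2, -, -⟩ := upperWeight_bounds hp
  rcases le_total 1 p.2 with h' | h'
  · calc p.2 ^ s ≤ p.2 ^ (M : ℝ) :=
          Real.rpow_le_rpow_of_exponent_le h' ((le_abs_self s).trans hs)
      _ = p.2 ^ M := Real.rpow_natCast _ _
      _ ≤ _ := by gcongr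
  · calc p.2 ^ s ≤ p.2 ^ (-(M : ℝ)) :=
          Real.rpow_le_rpow_of_exponent_ge h h' (by linarith [neg_abs_le s])
      _ = p.2⁻¹ ^ M := by rw [Real.rpow_neg h.le, Real.rpow_natCast, inv_pow]
      _ ≤ _ := by gcongr

lemma contDiffOn_snd_rpow (r : ℝ) : ContDiffOn ℝ ∞ (fun p : ℝ × ℝ => p.2 ^ r) upperHalf :=
  fun _ hp => (contDiffAt_snd.rpow_const_of_ne (ne_of_gt hp)).contDiffWithinAt

lemma norm_iteratedFDeriv_snd_rpow_le (r : ℝ) (k : ℕ) {p : ℝ × ℝ} (hp : p ∈ upperHalf) :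
    ‖iteratedFDerivWithin ℝ k (fun p : ℝ × ℝ => p.2 ^ r) upperHalf p‖ ≤
      |(descPochhammer ℝ k).eval r| * p.2 ^ (r - k) := by
  have h : 0 < p.2 := hp
  have hd : ContDiffOn ℝ k (fun y : ℝ => y ^ r) (Ioi 0) := fun y hy =>
    (Real.contDiffAt_rpow_const (Or.inl (ne_of_gt hy))).contDiffWithinAt
  have hU : upperHalf = ContinuousLinearMap.snd ℝ ℝ ℝ ⁻¹' Ioi 0 := rfl
  have hc := (ContinuousLinearMap.snd ℝ ℝ ℝ).iteratedFDerivWithin_comp_right hd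
    (uniqueDiffOn_Ioi 0) (by rw [← hU]; exact isOpen_upperHalf.uniqueDiffOn) (x := p) h le_rfl
  have hf : (fun p : ℝ × ℝ => p.2 ^ r) = (fun y : ℝ => y ^ r) ∘ ContinuousLinearMap.snd ℝ ℝ ℝ := rfl
  rw [hf, hU, hc]
  refine (ContinuousMultilinearMap.norm_compContinuousLinearMap_le _ _).trans ?_
  have h1 : ∏ _i : Fin k, ‖ContinuousLinearMap.snd ℝ ℝ ℝ‖ ≤ 1 :=
    Finset.prod_le_one (fun _ _ => norm_nonneg _) fun _ _ => ContinuousLinearMap.norm_snd_le ℝ ℝ ℝ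
  refine (mul_le_of_le_one_right (norm_nonneg _) h1).trans ?_
  rw [ContinuousLinearMap.coe_snd', norm_iteratedFDerivWithin_eq_norm_iteratedDerivWithin,
    iteratedDerivWithin_eq_iteratedDeriv (uniqueDiffOn_Ioi 0)
      (Real.contDiffAt_rpow_const (Or.inl (ne_of_gt h))) h, iteratedDeriv_eq_iterate,
    Real.iter_deriv_rpow_const, norm_mul, Real.norm_of_nonneg (Real.rpow_nonneg h.le _),
    Real.norm_eq_abs]

/-- In the Leibniz formula the i-th derivative of τ^r contributes τ^{r-i}, which a sufficiently high
power of the weight absorbs. -/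
lemma RapidlyDecreasing.rpow_smul {f : ℝ × ℝ → ℂ} (hf : RapidlyDecreasing f) (r : ℝ) :
    RapidlyDecreasing fun p => p.2 ^ r • f p := by
  refine ⟨(contDiffOn_snd_rpow r).smul hf.1, fun k N => ?_⟩
  choose C hC using hf.2
  have hM : ∀ j : ℕ, |r - j| ≤ (⌈|r - j|⌉₊ : ℕ) := fun j => Nat.le_ceil _
  refine ⟨∑ i ∈ Finset.range (k + 1), (k.choose i : ℝ) * |(descPochhammer ℝ i).eval r| *
    C (k - i) (N + ⌈|r - i|⌉₊), fun p hp => ?_⟩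
  set w := (p.1 ^ 2 + (1 + p.2) ^ 2) / p.2 with hw
  have hw1 : 1 ≤ w := (upperWeight_bounds hp).2.2.2
  rw [← iteratedFDerivWithin_of_isOpen k isOpen_upperHalf hp]
  refine (mul_le_mul_of_nonneg_left (norm_iteratedFDerivWithin_smul_le (contDiffOn_snd_rpow r) hf.1
    isOpen_upperHalf.uniqueDiffOn hp (by exact_mod_cast le_top)) (by positivity)).trans ?_
  rw [Finset.mul_sum]
  refine Finset.sum_le_sum fun i _ => ?_
  have h1 := norm_iteratedFDeriv_snd_rpow_le r i hp
  have h2 := rpow_le_upperWeight_pow hp (hM i)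
  have h3 := hC (k - i) (N + ⌈|r - i|⌉₊) p hp
  rw [← iteratedFDerivWithin_of_isOpen (k - i) isOpen_upperHalf hp, ← hw] at h3
  rw [← hw] at h2
  calc _ ≤ w ^ N * (k.choose i * (|(descPochhammer ℝ i).eval r| * w ^ ⌈|r - i|⌉₊) *
        ‖iteratedFDerivWithin ℝ (k - i) f upperHalf p‖) := by
        gcongr
        exact h1.trans (by gcongr)
    _ = k.choose i * |(descPochhammer ℝ i).eval r| * (w ^ (N + ⌈|r - i|⌉₊) *
        ‖iteratedFDerivWithin ℝ (k - i) f upperHalf p‖) := by ring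
    _ ≤ _ := by gcongr

/-- Outside the open half plane the weight with N = 2 bounds every derivative of g by a multiple of
τ², hence by the square of the distance to the chosen point. So each extended derivative is
differentiable there, with derivative zero. -/
lemma RapidlyDecreasing.hasFTaylorSeriesUpTo {g : ℝ × ℝ → ℂ} (hg : RapidlyDecreasing g) :
    HasFTaylorSeriesUpTo ∞ (upperHalf.indicator g)
      fun p k => upperHalf.indicator (iteratedFDeriv ℝ k g) p := by
  have hd : ∀ m : ℕ, ∀ x, HasFDerivAt (fun y => upperHalf.indicator (iteratedFDeriv ℝ m g) y)
      (upperHalf.indicator (iteratedFDeriv ℝ (m + 1) g) x).curryLeft x := by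
    intro m x
    by_cases hx : x ∈ upperHalf
    · have h1 : HasFDerivAt (iteratedFDeriv ℝ m g) (iteratedFDeriv ℝ (m + 1) g x).curryLeft x :=
        ((hg.1.contDiffAt (isOpen_upperHalf.mem_nhds hx)).differentiableAt_iteratedFDeriv
          (by exact_mod_cast ENat.natCast_lt_top m)).hasFDerivAt
      rw [indicator_of_mem hx]
      refine h1.congr_of_eventuallyEq ?_
      filter_upwards [isOpen_upperHalf.mem_nhds hx] with y hy
      rw [indicator_of_mem hy]
    · obtain ⟨C, hC⟩ := hg.2 m 2
      rw [indicator_of_notMem hx]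
      refine Asymptotics.IsBigO.hasFDerivAt (n := 2) (Asymptotics.IsBigO.of_bound |C| ?_) one_lt_two
      refine Eventually.of_forall fun y => ?_
      by_cases hy : y ∈ upperHalf
      · rw [indicator_of_mem hy, norm_pow, norm_norm]
        have hy0 : 0 < y.2 := hy
        have hx0 : x.2 ≤ 0 := not_lt.1 hx
        have h2 := (upperWeight_bounds hy).2.1
        have h3 : y.2 ≤ ‖y - x‖ := by
          refine le_trans ?_ (norm_snd_le (y - x))
          rw [Prod.snd_sub, Real.norm_eq_abs]
          exact le_trans (by linarith) (le_abs_self _)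
        have h4 := hC y hy
        have h5 : y.2⁻¹ ^ 2 * ‖iteratedFDeriv ℝ m g y‖ ≤ |C| :=
          le_trans (by gcongr) (h4.trans (le_abs_self C))
        calc _ = (y.2⁻¹ ^ 2 * ‖iteratedFDeriv ℝ m g y‖) * y.2 ^ 2 := by field_simp
          _ ≤ _ := by gcongr
      · rw [indicator_of_notMem hy, norm_zero]
        positivity
  refine ⟨fun x => ?_, fun m _ x => hd m x, fun m _ => ?_⟩
  · by_cases hx : x ∈ upperHalf
    · simp [indicator_of_mem hx]
    · simp [indicator_of_notMem hx]
  · exact continuous_iff_continuousAt.2 fun x => (hd m x).continuousAt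

/-- A rapidly decreasing function on the half plane, extended by zero, as a Schwartz function. -/
noncomputable def RapidlyDecreasing.schwartz {g : ℝ × ℝ → ℂ} (hg : RapidlyDecreasing g) :
    𝓢(ℝ × ℝ, ℂ) where
  toFun := upperHalf.indicator g
  smooth' := hg.hasFTaylorSeriesUpTo.contDiff
  decay' k n := by
    obtain ⟨C, hC⟩ := hg.2 n k
    refine ⟨|C|, fun x => ?_⟩
    rw [← hg.hasFTaylorSeriesUpTo.eq_iteratedFDeriv (by exact_mod_cast le_top) x]
    by_cases hx : x ∈ upperHalf
    · rw [indicator_of_mem hx]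
      refine le_trans ?_ ((hC x hx).trans (le_abs_self C))
      obtain ⟨h1, -, h2, -⟩ := upperWeight_bounds hx
      gcongr
      rw [Prod.norm_def]
      refine max_le h2 ?_
      rwa [Real.norm_of_nonneg (le_of_lt hx)]
    · rw [indicator_of_notMem hx, norm_zero, mul_zero]
      positivity

/-- The Schwartz function `ω + iτ ↦ τ^r f(ω, τ)` for `τ > 0`, extended by zero. -/
noncomputable def RapidlyDecreasing.weighted {f : ℝ × ℝ → ℂ} (hf : RapidlyDecreasing f) (r : ℝ) :
    𝓢(ℂ, ℂ) :=
  SchwartzMap.compCLMOfContinuousLinearEquiv ℝ Complex.equivRealProdCLM (hf.rpow_smul r).schwartz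

lemma RapidlyDecreasing.weighted_of_pos {f : ℝ × ℝ → ℂ} (hf : RapidlyDecreasing f) (r : ℝ) {z : ℂ}
    (hz : 0 < z.im) : hf.weighted r z = ((z.im ^ r : ℝ) : ℂ) * f (z.re, z.im) := by
  have h : Complex.equivRealProdCLM z ∈ upperHalf := hz
  change upperHalf.indicator (fun p : ℝ × ℝ => p.2 ^ r • f p) (Complex.equivRealProdCLM z) = _
  rw [indicator_of_mem h, Complex.real_smul]
  rfl

lemma RapidlyDecreasing.weighted_of_nonpos {f : ℝ × ℝ → ℂ} (hf : RapidlyDecreasing f) (r : ℝ)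
    {z : ℂ} (hz : z.im ≤ 0) : hf.weighted r z = 0 := by
  have h : Complex.equivRealProdCLM z ∉ upperHalf := not_lt.2 hz
  change upperHalf.indicator (fun p : ℝ × ℝ => p.2 ^ r • f p) (Complex.equivRealProdCLM z) = _
  rw [indicator_of_notMem h]

lemma RapidlyDecreasing.norm_weighted_mul_rpow {f : ℝ × ℝ → ℂ} (hf : RapidlyDecreasing f)
    (r s : ℝ) {z : ℂ} (hz : 0 < z.im) :
    ‖hf.weighted r z‖ * z.im ^ s = ‖hf.weighted (r + s) z‖ := by
  rw [hf.weighted_of_pos r hz, hf.weighted_of_pos _ hz, norm_mul, norm_mul, Real.rpow_add hz,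
    Complex.norm_real, Complex.norm_real, norm_mul, Real.norm_of_nonneg (Real.rpow_nonneg hz.le s)]
  ring

end

/-! ### The transform as a Fourier integral along a hyperbola. -/

section

open Filter Topology
open scoped SchwartzMap ContDiff FourierTransform

lemma stronglyMeasurable_besselMoment :
    StronglyMeasurable fun q : ℝ × ℝ => besselMoment q.1 0 q.2 := by
  unfold besselMoment
  refine StronglyMeasurable.integral_prod_right (f := fun (q : ℝ × ℝ) (u : ℝ) =>
    Real.cosh u ^ 0 * Real.exp (-(q.2 * Real.cosh u)) * Real.cos (q.1 * u)) ?_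
  refine Continuous.stronglyMeasurable ?_
  unfold Function.uncurry
  fun_prop

/-- The Fourier transform in `ω` combined with the Laplace transform in `τ`, at `|L| c`. -/
noncomputable def fourierLaplace (φ : 𝓢(ℂ, ℂ)) (L : ℝ) (c : ℂ) : ℂ :=
  ∫ z, φ z * Complex.exp (Complex.I * L * z.re - |L| * z.im * c)

/-- The transform of `φ` against `e^{iLω} K_{it}(|L|τ)`. -/
noncomputable def besselTransform (φ : 𝓢(ℂ, ℂ)) (L t : ℝ) : ℂ :=
  ∫ z, φ z * (Complex.exp (Complex.I * L * z.re) * (besselMoment t 0 (|L| * z.im) : ℂ))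

lemma norm_cexp_charge (L x : ℝ) : ‖Complex.exp (Complex.I * L * x)‖ = 1 := by
  rw [mul_assoc, ← Complex.ofReal_mul, mul_comm, Complex.norm_exp_ofReal_mul_I]

lemma norm_fourierLaplace_kernel (L : ℝ) (c z : ℂ) :
    ‖Complex.exp (Complex.I * L * z.re - |L| * z.im * c)‖ =
      Real.exp (-(|L| * z.im * c.re)) := by
  rw [Complex.norm_exp]
  congr 1
  rw [← Complex.ofReal_mul, Complex.sub_re, Complex.re_ofReal_mul]
  simp

lemma norm_fourierLaplace_kernel_le (L : ℝ) {c z : ℂ} (hc : 0 ≤ c.re) (hz : 0 ≤ z.im) :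
    ‖Complex.exp (Complex.I * L * z.re - |L| * z.im * c)‖ ≤ 1 := by
  rw [norm_fourierLaplace_kernel, Real.exp_le_one_iff]
  have : 0 ≤ |L| * z.im * c.re := by positivity
  linarith

lemma norm_mul_kernel_le {φ : 𝓢(ℂ, ℂ)} (h0 : ∀ z : ℂ, z.im ≤ 0 → φ z = 0)
    (L : ℝ) {c : ℂ} (hc : 0 ≤ c.re) (z : ℂ) :
    ‖φ z * Complex.exp (Complex.I * L * z.re - |L| * z.im * c)‖ ≤ ‖φ z‖ := by
  rcases le_or_gt z.im 0 with hz | hz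
  · simp [h0 z hz]
  · rw [norm_mul]
    exact mul_le_of_le_one_right (norm_nonneg _) (norm_fourierLaplace_kernel_le L hc hz.le)

/-- Strictly below the axis the kernel need not be bounded, but φ vanishes near the point and so
does its derivative; on and above the axis the kernel has norm at most 1. -/
lemma norm_fderiv_mul_kernel_le {φ : 𝓢(ℂ, ℂ)} (h0 : ∀ z : ℂ, z.im ≤ 0 → φ z = 0)
    (L : ℝ) {c : ℂ} (hc : 0 ≤ c.re) (z : ℂ) :
    ‖fderiv ℝ φ z Complex.I * Complex.exp (Complex.I * L * z.re - |L| * z.im * c)‖ ≤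
      ‖fderiv ℝ φ z‖ := by
  rcases lt_or_ge z.im 0 with hz | hz
  · have : fderiv ℝ φ z = 0 := by
      have : (φ : ℂ → ℂ) =ᶠ[𝓝 z] fun _ => 0 := by
        filter_upwards [(isOpen_lt Complex.continuous_im continuous_const).mem_nhds hz] with w hw
        exact h0 w (le_of_lt hw)
      rw [this.fderiv_eq]
      simp
    simp [this]
  · rw [norm_mul]
    refine (mul_le_of_le_one_right (norm_nonneg _)
      (norm_fourierLaplace_kernel_le L hc hz)).trans ?_
    simpa using (fderiv ℝ φ z).le_opNorm Complex.I

lemma norm_fourierLaplace_le {φ : 𝓢(ℂ, ℂ)} (h0 : ∀ z : ℂ, z.im ≤ 0 → φ z = 0)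
    (L : ℝ) {c : ℂ} (hc : 0 ≤ c.re) :
    ‖fourierLaplace φ L c‖ ≤ ∫ z, ‖φ z‖ :=
  norm_integral_le_of_norm_le φ.integrable.norm
    (Eventually.of_forall fun z => norm_mul_kernel_le h0 L hc z)

lemma integrable_mul_kernel {φ : 𝓢(ℂ, ℂ)} (h0 : ∀ z : ℂ, z.im ≤ 0 → φ z = 0)
    (L : ℝ) {c : ℂ} (hc : 0 ≤ c.re) :
    Integrable fun z => φ z * Complex.exp (Complex.I * L * z.re - |L| * z.im * c) :=
  φ.integrable.norm.mono' (Continuous.aestronglyMeasurable (by fun_prop))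
    (Eventually.of_forall fun z => norm_mul_kernel_le h0 L hc z)

/-- Integration by parts in τ, the direction `Complex.I`: there the kernel has logarithmic
derivative -|L|c, and no boundary term arises because φ is smooth across the axis. -/
lemma norm_mul_fourierLaplace_le {φ : 𝓢(ℂ, ℂ)} (h0 : ∀ z : ℂ, z.im ≤ 0 → φ z = 0)
    (L : ℝ) {c : ℂ} (hc : 0 ≤ c.re) :
    |L| * ‖c‖ * ‖fourierLaplace φ L c‖ ≤ ∫ z, ‖fderiv ℝ φ z‖ := by
  let E : ℂ → ℂ := fun z => Complex.exp (Complex.I * L * z.re - |L| * z.im * c)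
  have hE : ∀ z, HasFDerivAt E (E z • ((Complex.I * L) • Complex.ofRealCLM.comp Complex.reCLM
      - c • (((|L| : ℝ) : ℂ) • Complex.ofRealCLM.comp Complex.imCLM))) z := by
    intro z
    refine HasFDerivAt.cexp ?_
    refine HasFDerivAt.sub ?_ ?_
    · exact ((Complex.ofRealCLM.comp Complex.reCLM).hasFDerivAt (x := z)).const_mul _
    · exact (((Complex.ofRealCLM.comp Complex.imCLM).hasFDerivAt (x := z)).const_mul _).mul_const c
  have hEI : ∀ z, fderiv ℝ E z Complex.I = -(|L| * c) * E z := by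
    intro z
    rw [(hE z).fderiv]
    simp
    ring
  have hφ' : Integrable fun z => ‖fderiv ℝ φ z‖ :=
    (SchwartzMap.fderivCLM ℝ ℂ ℂ φ).integrable.norm
  have hint := integrable_mul_kernel h0 L hc
  have hφc : Continuous fun z => fderiv ℝ φ z Complex.I :=
    ((φ.smooth 1).continuous_fderiv one_ne_zero).clm_apply continuous_const
  have h1 : Integrable fun z => fderiv ℝ φ z Complex.I * E z :=
    hφ'.mono' (Continuous.aestronglyMeasurable (hφc.mul (by fun_prop)))
      (Eventually.of_forall fun z => norm_fderiv_mul_kernel_le h0 L hc z)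
  have h2 : Integrable fun z => φ z * fderiv ℝ E z Complex.I := by
    simp only [hEI]
    refine (hint.const_mul (-(|L| * c))).congr (Eventually.of_forall fun z => ?_)
    simp only [E]
    ring
  have key := integral_mul_fderiv_eq_neg_fderiv_mul_of_integrable h1 h2 hint
    (fun z _ => φ.differentiable z) (fun z _ => (hE z).differentiableAt)
  have h3 : ∫ z, φ z * fderiv ℝ E z Complex.I = -(|L| * c) * fourierLaplace φ L c := by
    rw [fourierLaplace, ← integral_const_mul]
    congr 1 with z
    rw [hEI]
    simp only [E]
    ring
  rw [h3] at key
  have h4 := congrArg norm key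
  rw [norm_mul, norm_neg, norm_mul, norm_neg, Complex.norm_real, Real.norm_eq_abs, abs_abs] at h4
  rw [h4]
  exact norm_integral_le_of_norm_le hφ'
    (Eventually.of_forall fun z => norm_fderiv_mul_kernel_le h0 L hc z)

/-- Since |cosh(u + iθ)|² = sinh² u + cos² θ, the gain of one power of |c| is a gain in cosh u that
does not degenerate as θ tends to π/2, although Re c then tends to 0. This is the dominating
function for the boundary limit. -/
lemma exists_norm_fourierLaplace_cosh_le {φ : 𝓢(ℂ, ℂ)} (h0 : ∀ z : ℂ, z.im ≤ 0 → φ z = 0)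
    {L : ℝ} (hL : L ≠ 0) : ∃ A : ℝ, ∀ u θ : ℝ,
    0 ≤ Real.cos θ →
      ‖fourierLaplace φ L (Complex.cosh (u + θ * Complex.I))‖ ≤ A * (Real.cosh u)⁻¹ := by
  refine ⟨(∫ z, ‖φ z‖) + (∫ z, ‖fderiv ℝ φ z‖) / |L|, fun u θ hθ => ?_⟩
  have hl := abs_pos.2 hL
  set c := Complex.cosh (u + θ * Complex.I) with hc
  have hcr : 0 ≤ c.re := by rw [hc, re_cosh_add_mul_I]; positivity
  have h1 := norm_fourierLaplace_le h0 L hcr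
  have h2 := norm_mul_fourierLaplace_le h0 L hcr
  have hs : |Real.sinh u| ≤ ‖c‖ := by
    have h3 : ‖c‖ ^ 2 = Real.sinh u ^ 2 + Real.cos θ ^ 2 := by
      rw [← Complex.normSq_eq_norm_sq, Complex.normSq_apply, hc, re_cosh_add_mul_I,
        im_cosh_add_mul_I]
      linear_combination (Real.cos θ) ^ 2 * Real.cosh_sq u
        + (Real.sinh u) ^ 2 * Real.sin_sq_add_cos_sq θ
    refine abs_le_of_sq_le_sq ?_ (norm_nonneg _)
    rw [h3]
    linarith [sq_nonneg (Real.cos θ)]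
  have hcosh : Real.cosh u ≤ 1 + |Real.sinh u| := by
    rw [Real.abs_sinh, ← Real.cosh_abs]
    have := Real.cosh_sub_sinh |u|
    have : Real.exp (-|u|) ≤ 1 := Real.exp_le_one_iff.2 (by simp)
    linarith
  have hG := norm_nonneg (fourierLaplace φ L c)
  rw [← div_eq_mul_inv, le_div_iff₀ (Real.cosh_pos u)]
  have h5 : ‖c‖ * ‖fourierLaplace φ L c‖ ≤ (∫ z, ‖fderiv ℝ φ z‖) / |L| := by
    rw [le_div_iff₀ hl]; linarith
  nlinarith

lemma aestronglyMeasurable_besselTransform (φ : 𝓢(ℂ, ℂ)) (L t : ℝ) : AEStronglyMeasurable fun z : ℂ =>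
    φ z * (Complex.exp (Complex.I * L * z.re) * (besselMoment t 0 (|L| * z.im) : ℂ)) := by
  have h1 : Measurable fun z : ℂ => besselMoment t 0 (|L| * z.im) :=
    stronglyMeasurable_besselMoment.measurable.comp
      (f := fun z : ℂ => (t, |L| * z.im)) (by fun_prop)
  have h2 : Measurable fun z : ℂ => Complex.exp (Complex.I * L * z.re) :=
    Continuous.measurable (by fun_prop)
  exact (φ.continuous.measurable.mul (h2.mul
    (Complex.measurable_ofReal.comp h1))).aestronglyMeasurable

lemma integrable_besselTransform {φ : 𝓢(ℂ, ℂ)} (h0 : ∀ z : ℂ, z.im ≤ 0 → φ z = 0)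
    {L : ℝ} (hL : L ≠ 0) (t : ℝ)
    (hint : Integrable fun z => ‖φ z‖ * z.im ^ (-(1 / 4) : ℝ)) : Integrable fun z =>
    φ z * (Complex.exp (Complex.I * L * z.re) * (besselMoment t 0 (|L| * z.im) : ℂ)) := by
  obtain ⟨C, hC0, hC⟩ := exists_abs_besselMoment_le
  refine (hint.const_mul (C * (1 + |t|) * |L| ^ (-(1 / 4) : ℝ) *
    Real.exp (-(Real.pi / 2 * |t|)))).mono' (aestronglyMeasurable_besselTransform φ L t) ?_
  refine Eventually.of_forall fun z => ?_
  rcases le_or_gt z.im 0 with hz | hz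
  · simp [h0 z hz]
  · rw [norm_mul, norm_mul, norm_cexp_charge, one_mul, Complex.norm_real, Real.norm_eq_abs]
    have hl := abs_pos.2 hL
    have := hC t (|L| * z.im) (mul_pos hl hz)
    rw [Real.mul_rpow hl.le hz.le] at this
    calc _ ≤ ‖φ z‖ * (C * (1 + |t|) * (|L| ^ (-(1 / 4) : ℝ) * z.im ^ (-(1 / 4) : ℝ)) *
          Real.exp (-(Real.pi / 2 * |t|))) := by gcongr
      _ = _ := by ring

/-- The bound carries (cos θ)^{-1/4}, which blows up at π/2. Fubini is therefore applied at interior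
heights only, and the boundary identity is reached as a limit. -/
lemma integrable_prod_hypKernel {φ : 𝓢(ℂ, ℂ)} (h0 : ∀ z : ℂ, z.im ≤ 0 → φ z = 0)
    {L : ℝ} (hL : L ≠ 0) (t : ℝ) {θ : ℝ} (hθ : |θ| < Real.pi / 2)
    (hint : Integrable fun z => ‖φ z‖ * z.im ^ (-(1 / 4) : ℝ)) :
    Integrable (fun q : ℂ × ℝ => φ q.1 * (Complex.exp (Complex.I * L * q.1.re) *
      hypKernel (|L| * q.1.im) t (q.2 + θ * Complex.I))) (volume.prod volume) := by
  have hc := Real.cos_pos_of_mem_Ioo (abs_lt.1 hθ)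
  have hl := abs_pos.2 hL
  refine (((hint.mul_prod integrable_cosh_rpow).const_mul
    ((|L| * Real.cos θ) ^ (-(1 / 4) : ℝ) * Real.exp (-(θ * t))))).mono' ?_ ?_
  · refine Continuous.aestronglyMeasurable ?_
    unfold hypKernel
    fun_prop
  · refine Eventually.of_forall fun q => ?_
    rcases le_or_gt q.1.im 0 with hz | hz
    · simp [h0 q.1 hz]
    · rw [norm_mul, norm_mul, norm_cexp_charge, one_mul, norm_hypKernel]
      have h1 := exp_neg_mul_cosh_le (mul_pos (mul_pos hl hz) hc) q.2
      have h2 : (|L| * q.1.im * Real.cos θ) ^ (-(1 / 4) : ℝ) =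
          (|L| * Real.cos θ) ^ (-(1 / 4) : ℝ) * q.1.im ^ (-(1 / 4) : ℝ) := by
        rw [mul_right_comm, Real.mul_rpow (mul_pos hl hc).le hz.le]
      rw [h2] at h1
      calc _ ≤ ‖φ q.1‖ * (((|L| * Real.cos θ) ^ (-(1 / 4) : ℝ) * q.1.im ^ (-(1 / 4) : ℝ) *
            Real.cosh q.2 ^ (-(1 / 4) : ℝ)) * Real.exp (-(θ * t))) := by gcongr
        _ = _ := by ring

lemma besselTransform_eq_shifted {φ : 𝓢(ℂ, ℂ)} (h0 : ∀ z : ℂ, z.im ≤ 0 → φ z = 0)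
    {L : ℝ} (hL : L ≠ 0) (t : ℝ) {θ : ℝ} (hθ : |θ| < Real.pi / 2)
    (hint : Integrable fun z => ‖φ z‖ * z.im ^ (-(1 / 4) : ℝ)) :
    ∫ u : ℝ, fourierLaplace φ L (Complex.cosh (u + θ * Complex.I)) *
      Complex.exp (Complex.I * t * u) = 2 * Real.exp (θ * t) * besselTransform φ L t := by
  have hl := abs_pos.2 hL
  have hsplit : ∀ (z : ℂ) (u : ℝ), (φ z * Complex.exp (Complex.I * L * z.re -
      |L| * z.im * Complex.cosh (u + θ * Complex.I))) * Complex.exp (Complex.I * t * u) =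
      Real.exp (θ * t) * (φ z * (Complex.exp (Complex.I * L * z.re) *
      hypKernel (|L| * z.im) t (u + θ * Complex.I))) := by
    intro z u
    rw [hypKernel, Complex.ofReal_exp, ← Complex.exp_add]
    have : ∀ a b c d : ℂ, a * Complex.exp b * Complex.exp c = a * Complex.exp (b + c) :=
      fun a b c _ => by rw [mul_assoc, Complex.exp_add]
    rw [this _ _ _ 0, mul_left_comm, ← Complex.exp_add]
    congr 2
    push_cast
    linear_combination (-(θ : ℂ) * t) * Complex.I_sq
  have hF := integrable_prod_hypKernel h0 hL t hθ hint
  calc _ = ∫ u : ℝ, ∫ z : ℂ, Real.exp (θ * t) * (φ z * (Complex.exp (Complex.I * L * z.re) *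
        hypKernel (|L| * z.im) t (u + θ * Complex.I))) := by
        congr 1 with u
        rw [fourierLaplace, ← integral_mul_const]
        congr 1 with z
        exact hsplit z u
    _ = Real.exp (θ * t) * ∫ u : ℝ, ∫ z : ℂ, φ z * (Complex.exp (Complex.I * L * z.re) *
        hypKernel (|L| * z.im) t (u + θ * Complex.I)) := by
        simp only [integral_const_mul]
    _ = Real.exp (θ * t) * ∫ z : ℂ, ∫ u : ℝ, φ z * (Complex.exp (Complex.I * L * z.re) *
        hypKernel (|L| * z.im) t (u + θ * Complex.I)) := by
        rw [integral_integral_swap (f := fun (u : ℝ) (z : ℂ) => φ z *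
          (Complex.exp (Complex.I * L * z.re) * hypKernel (|L| * z.im) t (u + θ * Complex.I)))
          hF.swap]
    _ = Real.exp (θ * t) * ∫ z : ℂ, 2 * (φ z * (Complex.exp (Complex.I * L * z.re) *
        (besselMoment t 0 (|L| * z.im) : ℂ))) := by
        congr 2 with z
        rcases le_or_gt z.im 0 with hz | hz
        · simp [h0 z hz]
        · rw [integral_const_mul, integral_const_mul, integral_hypKernel (mul_pos hl hz) t hθ]
          ring
    _ = _ := by rw [integral_const_mul, besselTransform]; ring

/-- The hyperbola `u ↦ -L/2π + i |L| sinh u / 2π` in frequency space. -/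
noncomputable def frequency (L u : ℝ) : ℂ :=
  ⟨-L / (2 * Real.pi), |L| * Real.sinh u / (2 * Real.pi)⟩

/-- At a purely imaginary argument the Laplace factor oscillates, so the two transforms merge into
one planar Fourier transform. -/
lemma fourierLaplace_sinh (φ : 𝓢(ℂ, ℂ)) (L u : ℝ) :
    fourierLaplace φ L (Complex.I * Real.sinh u) = 𝓕 (φ : ℂ → ℂ) (frequency L u) := by
  rw [Real.fourier_eq', fourierLaplace]
  congr 1 with z
  rw [smul_eq_mul, mul_comm]
  congr 2
  have : inner ℝ z (frequency L u) =
      z.re * (-L / (2 * Real.pi)) + z.im * (|L| * Real.sinh u / (2 * Real.pi)) := by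
    rw [Complex.inner]
    simp [frequency]
    ring
  rw [this]
  have hpi : (Real.pi : ℂ) ≠ 0 := by exact_mod_cast Real.pi_ne_zero
  push_cast
  field_simp
  ring

/-- `e^{πt/2}` times the Bessel transform is a one-dimensional Fourier integral. -/
lemma exp_mul_besselTransform {φ : 𝓢(ℂ, ℂ)} (h0 : ∀ z : ℂ, z.im ≤ 0 → φ z = 0)
    {L : ℝ} (hL : L ≠ 0) (t : ℝ)
    (hint : Integrable fun z => ‖φ z‖ * z.im ^ (-(1 / 4) : ℝ)) :
    2 * Real.exp (Real.pi / 2 * t) * besselTransform φ L t =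
      ∫ u : ℝ, 𝓕 (φ : ℂ → ℂ) (frequency L u) * Complex.exp (Complex.I * t * u) := by
  have hpi := Real.pi_pos
  obtain ⟨A, hA⟩ := exists_norm_fourierLaplace_cosh_le h0 hL
  have hev : ∀ᶠ θ : ℝ in 𝓝[<] (Real.pi / 2), |θ| < Real.pi / 2 := by
    filter_upwards [Ioo_mem_nhdsLT (by linarith : (0 : ℝ) < Real.pi / 2)] with θ hθ
    rw [abs_of_pos hθ.1]
    exact hθ.2
  have hl : Tendsto (fun θ : ℝ => 2 * (Real.exp (θ * t) : ℂ) * besselTransform φ L t)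
      (𝓝[<] (Real.pi / 2)) (𝓝 (2 * (Real.exp (Real.pi / 2 * t) : ℂ) * besselTransform φ L t)) := by
    refine (Continuous.tendsto ?_ _).mono_left nhdsWithin_le_nhds
    fun_prop
  have hcos : ∀ᶠ θ : ℝ in 𝓝[<] (Real.pi / 2), 0 ≤ Real.cos θ := by
    filter_upwards [hev] with θ hθ
    exact (Real.cos_pos_of_mem_Ioo (abs_lt.1 hθ)).le
  have hr : Tendsto (fun θ : ℝ => ∫ u : ℝ, fourierLaplace φ L (Complex.cosh (u + θ * Complex.I)) *
      Complex.exp (Complex.I * t * u)) (𝓝[<] (Real.pi / 2))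
      (𝓝 (∫ u : ℝ, 𝓕 (φ : ℂ → ℂ) (frequency L u) * Complex.exp (Complex.I * t * u))) := by
    refine tendsto_integral_filter_of_dominated_convergence (fun u => A * (Real.cosh u)⁻¹) ?_ ?_
      (integrable_inv_cosh.const_mul A) ?_
    · refine Eventually.of_forall fun θ => ?_
      refine AEStronglyMeasurable.mul ?_ (Continuous.aestronglyMeasurable (by fun_prop))
      refine StronglyMeasurable.aestronglyMeasurable ?_
      unfold fourierLaplace
      refine StronglyMeasurable.integral_prod_right (f := fun (u : ℝ) (z : ℂ) =>
        φ z * Complex.exp (Complex.I * L * z.re - |L| * z.im * Complex.cosh (u + θ * Complex.I))) ?_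
      refine Continuous.stronglyMeasurable ?_
      unfold Function.uncurry
      fun_prop
    · filter_upwards [hcos] with θ hθ
      refine Eventually.of_forall fun u => ?_
      rw [norm_mul, norm_cexp_charge, mul_one]
      exact hA u θ hθ
    · refine Eventually.of_forall fun u => Tendsto.mul_const _ ?_
      rw [← fourierLaplace_sinh]
      have hlim : Complex.I * Real.sinh u = Complex.cosh (u + (Real.pi / 2 : ℝ) * Complex.I) := by
        apply Complex.ext
        · rw [re_cosh_add_mul_I]; simp
        · rw [im_cosh_add_mul_I]; simp [Complex.sinh_ofReal_re]
      rw [hlim]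
      refine tendsto_integral_filter_of_dominated_convergence (fun z => ‖φ z‖) ?_ ?_
        φ.integrable.norm ?_
      · exact Eventually.of_forall fun θ => Continuous.aestronglyMeasurable (by fun_prop)
      · filter_upwards [hcos] with θ hθ
        refine Eventually.of_forall fun z => norm_mul_kernel_le h0 L ?_ z
        rw [re_cosh_add_mul_I]
        positivity
      · refine Eventually.of_forall fun z => ?_
        refine Tendsto.mono_left (Continuous.tendsto ?_ _) nhdsWithin_le_nhds
        fun_prop
  refine tendsto_nhds_unique hl (hr.congr' ?_)
  filter_upwards [hev] with θ hθ
  exact besselTransform_eq_shifted h0 hL t hθ hint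

end

/-! ### Decay of Fourier integrals along the hyperbola. -/

section

open Filter Topology
open scoped SchwartzMap ContDiff FourierTransform

lemma frequency_eq (L u : ℝ) : frequency L u =
    ((-L / (2 * Real.pi) : ℝ) : ℂ) + Real.sinh u • ((|L| / (2 * Real.pi) : ℝ) * Complex.I) := by
  rw [frequency, mul_div_right_comm]
  generalize |L| / (2 * Real.pi) = a
  generalize -L / (2 * Real.pi) = b
  generalize Real.sinh u = s
  apply Complex.ext <;> simp [mul_comm]

lemma norm_frequency (L u : ℝ) : ‖frequency L u‖ = |L| / (2 * Real.pi) * Real.cosh u := by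
  have hpi := Real.pi_pos
  have h : ‖frequency L u‖ ^ 2 = (|L| / (2 * Real.pi) * Real.cosh u) ^ 2 := by
    rw [← Complex.normSq_eq_norm_sq, Complex.normSq_apply]
    simp only [frequency]
    rw [mul_pow, Real.cosh_sq, div_pow, sq_abs]
    linear_combination (Real.sinh u ^ 2 / (2 * Real.pi) ^ 2) * sq_abs L
  exact (sq_eq_sq₀ (norm_nonneg _) (by positivity)).1 h

lemma contDiff_frequency (L : ℝ) : ContDiff ℝ ∞ (frequency L) := by
  have : frequency L = fun u => ((-L / (2 * Real.pi) : ℝ) : ℂ) +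
      Real.sinh u • ((|L| / (2 * Real.pi) : ℝ) * Complex.I) := funext (frequency_eq L)
  rw [this]
  exact contDiff_const.add (Real.contDiff_sinh.smul contDiff_const)

lemma norm_iteratedDeriv_hyperbolic_le (v : ℂ) (j : ℕ) (u : ℝ) :
    ‖iteratedDeriv j (fun u : ℝ => Real.cosh u • v) u‖ ≤ Real.cosh u * ‖v‖ ∧
      ‖iteratedDeriv j (fun u : ℝ => Real.sinh u • v) u‖ ≤ Real.cosh u * ‖v‖ := by
  induction j with
  | zero =>
    simp only [iteratedDeriv_zero, norm_smul, Real.norm_eq_abs, abs_of_pos (Real.cosh_pos u)]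
    refine ⟨le_rfl, ?_⟩
    gcongr
    rw [Real.abs_sinh, ← Real.cosh_abs]
    exact (Real.sinh_lt_cosh _).le
  | succ j ih =>
    have h1 : deriv (fun u : ℝ => Real.cosh u • v) = fun u : ℝ => Real.sinh u • v :=
      funext fun u => ((Real.hasDerivAt_cosh u).smul_const v).deriv
    have h2 : deriv (fun u : ℝ => Real.sinh u • v) = fun u : ℝ => Real.cosh u • v :=
      funext fun u => ((Real.hasDerivAt_sinh u).smul_const v).deriv
    rw [iteratedDeriv_succ', iteratedDeriv_succ', h1, h2]
    exact ⟨ih.2, ih.1⟩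

lemma norm_iteratedDeriv_frequency_le (L : ℝ) (j : ℕ) (u : ℝ) :
    ‖iteratedDeriv (j + 1) (frequency L) u‖ ≤ ‖frequency L u‖ := by
  have h : deriv (frequency L) = fun u => Real.cosh u • ((|L| / (2 * Real.pi) : ℝ) * Complex.I) := by
    ext u
    rw [funext (frequency_eq L)]
    exact (((Real.hasDerivAt_sinh u).smul_const _).const_add _).deriv
  rw [iteratedDeriv_succ', h, norm_frequency]
  refine (norm_iteratedDeriv_hyperbolic_le _ j u).1.trans (le_of_eq ?_)
  rw [norm_mul, Complex.norm_I, Complex.norm_real, mul_one, Real.norm_of_nonneg (by positivity),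
    mul_comm]

lemma contDiff_comp_frequency (Φ : 𝓢(ℂ, ℂ)) (L : ℝ) :
    ContDiff ℝ ∞ fun u => Φ (frequency L u) :=
  (Φ.smooth ⊤).comp (contDiff_frequency L)

/-- Each derivative of the hyperbola of positive order is no longer than the position vector itself,
so k derivatives cost at most k powers of 1 + ‖`frequency`‖. Schwartz seminorms of order k + m pay
for them and leave m powers. -/
lemma exists_norm_iteratedDeriv_comp_frequency_le (Φ : 𝓢(ℂ, ℂ)) (k m : ℕ) :
    ∃ C : ℝ, 0 ≤ C ∧ ∀ L u : ℝ,
      ‖iteratedDeriv k (fun u => Φ (frequency L u)) u‖ * (1 + |L| * Real.cosh u) ^ m ≤ C := by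
  set A := 2 ^ (k + m) *
    (Finset.Iic (k + m, k)).sup (fun m => SchwartzMap.seminorm ℝ m.1 m.2) Φ with hA
  have hA0 : 0 ≤ A := by positivity
  refine ⟨k.factorial * A * 8 ^ m, by positivity, fun L u => ?_⟩
  set D := 1 + ‖frequency L u‖ with hD
  have hD1 : 1 ≤ D := by linarith [norm_nonneg (frequency L u)]
  have h1 : ‖iteratedDeriv k (fun u => Φ (frequency L u)) u‖ ≤
      k.factorial * (A / D ^ (k + m)) * D ^ k := by
    rw [← norm_iteratedFDeriv_eq_norm_iteratedDeriv]
    refine norm_iteratedFDeriv_comp_le (g := Φ) (f := frequency L) (N := ∞) (Φ.smooth ⊤)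
      (contDiff_frequency L) (by exact_mod_cast le_top) u (fun i hi => ?_) (fun i hi _ => ?_)
    · rw [le_div_iff₀ (by positivity), mul_comm]
      exact SchwartzMap.one_add_le_sup_seminorm_apply (𝕜 := ℝ) (m := (k + m, k)) le_rfl hi Φ _
    · obtain ⟨j, rfl⟩ := Nat.exists_eq_add_of_le' hi
      rw [norm_iteratedFDeriv_eq_norm_iteratedDeriv]
      calc _ ≤ ‖frequency L u‖ := norm_iteratedDeriv_frequency_le L j u
        _ ≤ D := by linarith
        _ ≤ D ^ (j + 1) := le_self_pow₀ hD1 (Nat.succ_ne_zero j)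
  -- The 8 is a rounding of 2π, as |L| cosh u = 2π ‖`frequency L u`‖.
  have h2 : 1 + |L| * Real.cosh u ≤ 8 * D := by
    have h3 : |L| * Real.cosh u = 2 * Real.pi * ‖frequency L u‖ := by
      rw [norm_frequency]
      field_simp
    rw [h3, hD]
    nlinarith [Real.pi_le_four, norm_nonneg (frequency L u)]
  have hy : 0 ≤ 1 + |L| * Real.cosh u := by have := Real.cosh_pos u; positivity
  calc _ ≤ (k.factorial * (A / D ^ (k + m)) * D ^ k) * (8 * D) ^ m := by gcongr
    _ = _ := by
      rw [pow_add, mul_pow]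
      field_simp

/-- Of three powers of 1 + |L| cosh u, two yield integrability in L at infinity; the third is
weakened to (|L| cosh u)^{-1/4}, which gives integrability in u at the price of a mild singularity
at L = 0. -/
lemma exists_norm_iteratedDeriv_comp_frequency_le_rpow (Φ : 𝓢(ℂ, ℂ)) (k : ℕ) :
    ∃ C : ℝ, 0 ≤ C ∧ ∀ L u : ℝ, L ≠ 0 →
      ‖iteratedDeriv k (fun u => Φ (frequency L u)) u‖ ≤
        C * ((1 + L ^ 2)⁻¹ * |L| ^ (-(1 / 4) : ℝ)) * Real.cosh u ^ (-(1 / 4) : ℝ) := by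
  obtain ⟨C, hC0, hC⟩ := exists_norm_iteratedDeriv_comp_frequency_le Φ k 3
  refine ⟨C, hC0, fun L u hL => ?_⟩
  have hl := abs_pos.2 hL
  have hu := Real.cosh_pos u
  have hu1 := Real.one_le_cosh u
  have hlu : 0 < |L| * Real.cosh u := mul_pos hl hu
  set Y := 1 + |L| * Real.cosh u with hY
  have hY1 : 1 ≤ Y := by linarith
  have h1 : 1 + L ^ 2 ≤ Y ^ 2 := by
    rw [← sq_abs L]
    have : |L| ≤ |L| * Real.cosh u := le_mul_of_one_le_right hl.le hu1
    rw [hY]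
    nlinarith
  have h2 : Y⁻¹ ≤ |L| ^ (-(1 / 4) : ℝ) * Real.cosh u ^ (-(1 / 4) : ℝ) := by
    rw [← Real.mul_rpow hl.le hu.le, ← Real.rpow_neg_one]
    calc Y ^ (-1 : ℝ) ≤ Y ^ (-(1 / 4) : ℝ) :=
          Real.rpow_le_rpow_of_exponent_le hY1 (by norm_num)
      _ ≤ _ := Real.rpow_le_rpow_of_nonpos hlu (by linarith) (by norm_num)
  have h3 := hC L u
  calc _ ≤ C * ((Y ^ 2)⁻¹ * Y⁻¹) := by
        rw [← le_div_iff₀ (by positivity)] at h3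
        refine h3.trans (le_of_eq ?_)
        rw [← hY]
        field_simp
    _ ≤ C * ((1 + L ^ 2)⁻¹ * (|L| ^ (-(1 / 4) : ℝ) * Real.cosh u ^ (-(1 / 4) : ℝ))) := by
        gcongr
    _ = _ := by ring

lemma integrable_iteratedDeriv_comp_frequency (Φ : 𝓢(ℂ, ℂ)) (k : ℕ) {L : ℝ} (hL : L ≠ 0) :
    Integrable (iteratedDeriv k fun u => Φ (frequency L u)) := by
  obtain ⟨C, hC0, hC⟩ := exists_norm_iteratedDeriv_comp_frequency_le_rpow Φ k
  refine (integrable_cosh_rpow.const_mul (C * ((1 + L ^ 2)⁻¹ * |L| ^ (-(1 / 4) : ℝ)))).mono' ?_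
    (Eventually.of_forall fun u => hC L u hL)
  exact ((contDiff_comp_frequency Φ L).continuous_iteratedDeriv k
    (by exact_mod_cast le_top)).aestronglyMeasurable

/-- The Fourier integral of `Φ` along the hyperbola. -/
noncomputable def hyperbolaFourier (Φ : 𝓢(ℂ, ℂ)) (L t : ℝ) : ℂ :=
  ∫ u : ℝ, Φ (frequency L u) * Complex.exp (Complex.I * t * u)

lemma hyperbolaFourier_eq_fourier (Φ : 𝓢(ℂ, ℂ)) (L t : ℝ) :
    hyperbolaFourier Φ L t = 𝓕 (fun u : ℝ => Φ (frequency L u)) (-t / (2 * Real.pi)) := by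
  rw [Real.fourier_eq', hyperbolaFourier]
  congr 1 with u
  rw [smul_eq_mul, mul_comm]
  congr 2
  have hpi : (Real.pi : ℂ) ≠ 0 := by exact_mod_cast Real.pi_ne_zero
  simp only [RCLike.inner_apply, conj_trivial]
  push_cast
  field_simp

lemma norm_pow_mul_hyperbolaFourier_le (Φ : 𝓢(ℂ, ℂ)) (k : ℕ) {L : ℝ} (hL : L ≠ 0) (t : ℝ) :
    |t| ^ k * ‖hyperbolaFourier Φ L t‖ ≤
      ∫ u : ℝ, ‖iteratedDeriv k (fun u => Φ (frequency L u)) u‖ := by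
  have h := congrFun (Real.fourier_iteratedDeriv (N := ⊤) (n := k)
    (contDiff_comp_frequency Φ L)
    (fun n _ => integrable_iteratedDeriv_comp_frequency Φ n hL) le_top) (-t / (2 * Real.pi))
  have h1 : ‖(2 * Real.pi * Complex.I * ((-t / (2 * Real.pi) : ℝ) : ℂ)) ^ k‖ = |t| ^ k := by
    rw [norm_pow]
    congr 1
    have hpi : (Real.pi : ℂ) ≠ 0 := by exact_mod_cast Real.pi_ne_zero
    have : 2 * Real.pi * Complex.I * ((-t / (2 * Real.pi) : ℝ) : ℂ) = -(t : ℂ) * Complex.I := by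
      push_cast
      field_simp
    rw [this, norm_mul, norm_neg, Complex.norm_I, mul_one, Complex.norm_real, Real.norm_eq_abs]
  rw [hyperbolaFourier_eq_fourier, ← h1, ← norm_smul]
  rw [← h]
  rw [Real.fourier_eq']
  refine (norm_integral_le_integral_norm _).trans (le_of_eq ?_)
  congr 1 with u
  rw [norm_smul, Complex.norm_exp_ofReal_mul_I, one_mul]

/-- Zero and four derivatives in u are combined. The fourth power of t is enough to integrate
against |t|(1 + |t|), where |t| is the density's factor and 1 + |t| the loss in the bound for K. -/
lemma exists_norm_hyperbolaFourier_le (Φ : 𝓢(ℂ, ℂ)) : ∃ C : ℝ, 0 ≤ C ∧ ∀ L t : ℝ, L ≠ 0 →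
    ‖hyperbolaFourier Φ L t‖ ≤
      C * ((1 + L ^ 2)⁻¹ * |L| ^ (-(1 / 4) : ℝ)) * (1 + t ^ 4)⁻¹ := by
  obtain ⟨C₀, h₀, hC₀⟩ := exists_norm_iteratedDeriv_comp_frequency_le_rpow Φ 0
  obtain ⟨C₄, h₄, hC₄⟩ := exists_norm_iteratedDeriv_comp_frequency_le_rpow Φ 4
  set A : ℝ := ∫ u : ℝ, Real.cosh u ^ (-(1 / 4) : ℝ) with hA
  have hA0 : 0 ≤ A := integral_nonneg fun u => Real.rpow_nonneg (Real.cosh_pos u).le _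
  refine ⟨(C₀ + C₄) * A, by positivity, fun L t hL => ?_⟩
  have key : ∀ (k : ℕ) (C : ℝ), (∀ L u : ℝ, L ≠ 0 →
      ‖iteratedDeriv k (fun u => Φ (frequency L u)) u‖ ≤
        C * ((1 + L ^ 2)⁻¹ * |L| ^ (-(1 / 4) : ℝ)) * Real.cosh u ^ (-(1 / 4) : ℝ)) →
      |t| ^ k * ‖hyperbolaFourier Φ L t‖ ≤ C * ((1 + L ^ 2)⁻¹ * |L| ^ (-(1 / 4) : ℝ)) * A := by
    intro k C hC
    refine (norm_pow_mul_hyperbolaFourier_le Φ k hL t).trans ?_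
    rw [hA, ← integral_const_mul]
    exact integral_mono (integrable_iteratedDeriv_comp_frequency Φ k hL).norm
      (integrable_cosh_rpow.const_mul _) fun u => hC L u hL
  have k0 := key 0 C₀ hC₀
  have k4 := key 4 C₄ hC₄
  rw [← abs_pow, abs_of_nonneg (by positivity : 0 ≤ t ^ 4)] at k4
  rw [← div_eq_mul_inv, le_div_iff₀ (by positivity)]
  linarith

lemma besselTransform_neg (φ : 𝓢(ℂ, ℂ)) (L t : ℝ) :
    besselTransform φ L (-t) = besselTransform φ L t := by
  simp only [besselTransform, besselMoment_neg]

lemma two_mul_exp_mul_besselTransform {φ : 𝓢(ℂ, ℂ)} (h0 : ∀ z : ℂ, z.im ≤ 0 → φ z = 0)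
    {L : ℝ} (hL : L ≠ 0) (t : ℝ)
    (hint : Integrable fun z => ‖φ z‖ * z.im ^ (-(1 / 4) : ℝ)) :
    2 * Real.exp (Real.pi / 2 * t) * besselTransform φ L t = hyperbolaFourier (𝓕 φ) L t :=
  exp_mul_besselTransform h0 hL t hint

/-- For t ≥ 0 the factor e^{πt/2} is divided out of the hyperbola integral; evenness in t covers t <
0. -/
lemma exists_norm_besselTransform_le {φ : 𝓢(ℂ, ℂ)} (h0 : ∀ z : ℂ, z.im ≤ 0 → φ z = 0)
    (hint : Integrable fun z => ‖φ z‖ * z.im ^ (-(1 / 4) : ℝ)) :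
    ∃ C : ℝ, 0 ≤ C ∧ ∀ L t : ℝ, L ≠ 0 → ‖besselTransform φ L t‖ ≤
      C * ((1 + L ^ 2)⁻¹ * |L| ^ (-(1 / 4) : ℝ)) * (1 + t ^ 4)⁻¹ *
        Real.exp (-(Real.pi / 2 * |t|)) := by
  obtain ⟨C, hC0, hC⟩ := exists_norm_hyperbolaFourier_le (𝓕 φ)
  refine ⟨C, hC0, fun L t hL => ?_⟩
  wlog ht : 0 ≤ t generalizing t
  · have := this (-t) (by linarith)
    rwa [besselTransform_neg, abs_neg, Even.neg_pow (by decide)] at this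
  have h1 := hC L t hL
  rw [← two_mul_exp_mul_besselTransform h0 hL t hint, norm_mul, norm_mul, Complex.norm_ofNat,
    Complex.norm_real, Real.norm_of_nonneg (Real.exp_pos _).le] at h1
  rw [abs_of_nonneg ht, Real.exp_neg, ← div_eq_mul_inv, le_div_iff₀ (Real.exp_pos _)]
  have h2 : 0 ≤ Real.exp (Real.pi / 2 * t) * ‖besselTransform φ L t‖ := by positivity
  linarith

end

/-! ### Kontorovich–Lebedev inversion on a fixed hyperbola. -/

section

open Filter Topology
open scoped SchwartzMap ContDiff FourierTransform

lemma integrable_quadratic_div_quartic :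
    Integrable fun t : ℝ => |t| * (1 + |t|) * (1 + t ^ 4)⁻¹ := by
  refine (integrable_inv_one_add_sq.const_mul 4).mono' ?_ ?_
  · refine Continuous.aestronglyMeasurable ?_
    exact (by fun_prop : Continuous fun t : ℝ => |t| * (1 + |t|)).mul
      ((by fun_prop : Continuous fun t : ℝ => 1 + t ^ 4).inv₀ fun t => by positivity)
  · refine Eventually.of_forall fun t => ?_
    rw [Real.norm_of_nonneg (by positivity), ← div_eq_mul_inv, ← div_eq_mul_inv,
      div_le_div_iff₀ (by positivity) (by positivity), ← sq_abs t,
      ← abs_of_nonneg (by positivity : 0 ≤ t ^ 4), abs_pow]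
    have h := abs_nonneg t
    generalize |t| = a at *
    nlinarith [sq_nonneg (a - 1), sq_nonneg (a ^ 2 - 1), sq_nonneg (a ^ 2 - a), mul_nonneg h h]

lemma stronglyMeasurable_hyperbolaFourier (Φ : 𝓢(ℂ, ℂ)) :
    StronglyMeasurable fun q : ℝ × ℝ => hyperbolaFourier Φ q.1 q.2 := by
  unfold hyperbolaFourier
  refine StronglyMeasurable.integral_prod_right (f := fun (q : ℝ × ℝ) (u : ℝ) =>
    Φ (frequency q.1 u) * Complex.exp (Complex.I * q.2 * u)) ?_
  refine Continuous.stronglyMeasurable ?_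
  unfold Function.uncurry
  simp only [frequency_eq]
  fun_prop

variable (Φ : 𝓢(ℂ, ℂ))

lemma exists_norm_mul_hyperbolaFourier_le {L : ℝ} (hL : L ≠ 0) : ∃ C : ℝ, 0 ≤ C ∧ ∀ t : ℝ,
    ‖t * hyperbolaFourier Φ L t‖ ≤ C * (|t| * (1 + t ^ 4)⁻¹) := by
  obtain ⟨C, hC0, hC⟩ := exists_norm_hyperbolaFourier_le Φ
  refine ⟨C * ((1 + L ^ 2)⁻¹ * |L| ^ (-(1 / 4) : ℝ)), by positivity, fun t => ?_⟩
  rw [norm_mul, Complex.norm_real, Real.norm_eq_abs]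
  calc _ ≤ |t| * (C * ((1 + L ^ 2)⁻¹ * |L| ^ (-(1 / 4) : ℝ)) * (1 + t ^ 4)⁻¹) := by
        gcongr
        exact hC L t hL
    _ = _ := by ring

lemma aestronglyMeasurable_mul_hyperbolaFourier (L : ℝ) :
    AEStronglyMeasurable fun t : ℝ => (t : ℂ) * hyperbolaFourier Φ L t := by
  refine AEStronglyMeasurable.mul (Continuous.aestronglyMeasurable (by fun_prop)) ?_
  exact ((stronglyMeasurable_hyperbolaFourier Φ).comp_measurable
    (g := fun t : ℝ => (L, t)) (by fun_prop)).aestronglyMeasurable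

lemma integrable_mul_hyperbolaFourier {L : ℝ} (hL : L ≠ 0) :
    Integrable fun t : ℝ => (t : ℂ) * hyperbolaFourier Φ L t := by
  obtain ⟨C, hC0, hC⟩ := exists_norm_mul_hyperbolaFourier_le Φ hL
  refine (integrable_quadratic_div_quartic.const_mul C).mono'
    (aestronglyMeasurable_mul_hyperbolaFourier Φ L) (Eventually.of_forall fun t => ?_)
  refine (hC t).trans ?_
  gcongr
  exact le_mul_of_one_le_right (abs_nonneg t) (by linarith [abs_nonneg t])

lemma mul_hyperbolaFourier_eq {L : ℝ} (hL : L ≠ 0) (t : ℝ) :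
    t * hyperbolaFourier Φ L t =
      Complex.I * 𝓕 (deriv fun u => Φ (frequency L u)) (-t / (2 * Real.pi)) := by
  have h0 := integrable_iteratedDeriv_comp_frequency Φ 0 hL
  have h1 := integrable_iteratedDeriv_comp_frequency Φ 1 hL
  rw [iteratedDeriv_zero] at h0
  rw [iteratedDeriv_one] at h1
  rw [Real.fourier_deriv h0 ((contDiff_comp_frequency Φ L).differentiable (by simp)) h1,
    hyperbolaFourier_eq_fourier]
  simp only [smul_eq_mul]
  have hpi : (Real.pi : ℂ) ≠ 0 := by exact_mod_cast Real.pi_ne_zero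
  generalize 𝓕 (fun u => Φ (frequency L u)) (-t / (2 * Real.pi)) = J
  push_cast
  field_simp
  linear_combination (t * J) * Complex.I_sq

lemma continuous_deriv_comp_frequency (L : ℝ) :
    Continuous (deriv fun u => Φ (frequency L u)) :=
  (contDiff_comp_frequency Φ L).continuous_deriv (by simp)

/-- One-dimensional Fourier inversion for the derivative along the hyperbola, which the factor t
encodes. The argument -v appears because `hyperbolaFourier` and the outer exponential carry the same
sign. -/
lemma integral_mul_hyperbolaFourier {L : ℝ} (hL : L ≠ 0) (v : ℝ) :
    ∫ t : ℝ, t * hyperbolaFourier Φ L t * Complex.exp (Complex.I * t * v) =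
      2 * Real.pi * Complex.I * deriv (fun u => Φ (frequency L u)) (-v) := by
  set B' := deriv fun u => Φ (frequency L u) with hB'
  have hpi := Real.pi_pos
  have h1 : Integrable B' := by
    have := integrable_iteratedDeriv_comp_frequency Φ 1 hL
    rwa [iteratedDeriv_one] at this
  have hF : ∀ s : ℝ, 𝓕 B' s = -Complex.I * (((-(2 * Real.pi)) * s : ℝ) *
      hyperbolaFourier Φ L ((-(2 * Real.pi)) * s)) := by
    intro s
    rw [mul_hyperbolaFourier_eq Φ hL, ← mul_assoc, neg_mul, Complex.I_mul_I, neg_neg, one_mul]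
    field_simp
    rfl
  have h2 : Integrable (𝓕 B') := by
    have := ((integrable_mul_hyperbolaFourier Φ hL).comp_mul_left'
      (R := -(2 * Real.pi)) (by linarith)).const_mul (-Complex.I)
    exact this.congr (Eventually.of_forall fun s => (hF s).symm)
  have h3 := h1.fourierInv_fourier_eq h2 (v := -v) (continuous_deriv_comp_frequency Φ L).continuousAt
  rw [← h3, Real.fourierInv_eq']
  have h4 := Measure.integral_comp_mul_left (fun t : ℝ => (t : ℂ) * hyperbolaFourier Φ L t *
    Complex.exp (Complex.I * t * v)) (-(2 * Real.pi))
  have h5 : ∫ s : ℝ, Complex.exp (((2 * Real.pi * inner ℝ s (-v) : ℝ) : ℂ) * Complex.I) • 𝓕 B' s =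
      -Complex.I * ∫ s : ℝ, ((-(2 * Real.pi) * s : ℝ) : ℂ) *
        hyperbolaFourier Φ L (-(2 * Real.pi) * s) *
        Complex.exp (Complex.I * (-(2 * Real.pi) * s : ℝ) * v) := by
    rw [← integral_const_mul]
    congr 1 with s
    have hE : ((2 * Real.pi * inner ℝ s (-v) : ℝ) : ℂ) * Complex.I =
        Complex.I * (-(2 * Real.pi) * s : ℝ) * v := by
      simp only [RCLike.inner_apply, conj_trivial]
      push_cast
      ring
    rw [hF, smul_eq_mul, hE]
    ring
  rw [h5, h4, abs_inv, abs_neg, abs_of_pos (by positivity), Complex.real_smul]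
  have hpi' : (Real.pi : ℂ) ≠ 0 := by exact_mod_cast Real.pi_ne_zero
  generalize (∫ t : ℝ, (t : ℂ) * hyperbolaFourier Φ L t * Complex.exp (Complex.I * t * v)) = J
  push_cast
  field_simp
  rw [Complex.I_sq]
  ring

lemma integral_mul_hyperbolaFourier_mul_bessel {L : ℝ} (hL : L ≠ 0) {x : ℝ} (hx : 0 < x) {θ : ℝ}
    (hθ : |θ| < Real.pi / 2) :
    ∫ t : ℝ, t * hyperbolaFourier Φ L t * (2 * Real.exp (θ * t) * (besselMoment t 0 x : ℂ)) =
      2 * Real.pi * Complex.I * ∫ v : ℝ, Complex.exp (-(x * Complex.cosh (v + θ * Complex.I))) *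
        deriv (fun u => Φ (frequency L u)) (-v) := by
  have hK : ∀ t : ℝ, 2 * (Real.exp (θ * t) : ℂ) * (besselMoment t 0 x : ℂ) =
      ∫ v : ℝ, Complex.exp (-(x * Complex.cosh (v + θ * Complex.I))) *
        Complex.exp (Complex.I * t * v) := by
    intro t
    rw [mul_right_comm, ← integral_hypKernel hx t hθ, ← integral_mul_const]
    congr 1 with v
    rw [hypKernel, Complex.ofReal_exp, ← Complex.exp_add, ← Complex.exp_add]
    congr 1
    push_cast
    linear_combination ((θ : ℂ) * t) * Complex.I_sq
  have hker : Integrable fun v : ℝ => Complex.exp (-(x * Complex.cosh (v + θ * Complex.I))) := by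
    simpa [hypKernel] using integrable_hypKernel hx 0 hθ
  have hprod : Integrable (Function.uncurry fun (t v : ℝ) => t * hyperbolaFourier Φ L t *
      (Complex.exp (-(x * Complex.cosh (v + θ * Complex.I))) * Complex.exp (Complex.I * t * v)))
      (volume.prod volume) := by
    have h := (integrable_mul_hyperbolaFourier Φ hL).mul_prod hker
    refine (h.norm).mono' ?_ ?_
    · have h2 : Continuous fun q : ℝ × ℝ => Complex.exp (Complex.I * q.1 * q.2) := by fun_prop
      refine (h.aestronglyMeasurable.mul h2.aestronglyMeasurable).congr
        (Eventually.of_forall fun q => ?_)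
      simp only [Function.uncurry, Pi.mul_apply]
      ring
    · refine Eventually.of_forall fun q => ?_
      simp only [Function.uncurry]
      rw [norm_mul, norm_mul _ (Complex.exp (Complex.I * q.1 * q.2)), norm_cexp_charge, mul_one,
        ← norm_mul]
  calc _ = ∫ t : ℝ, ∫ v : ℝ, t * hyperbolaFourier Φ L t *
        (Complex.exp (-(x * Complex.cosh (v + θ * Complex.I))) *
          Complex.exp (Complex.I * t * v)) := by
        congr 1 with t
        rw [hK, integral_const_mul]
    _ = ∫ v : ℝ, ∫ t : ℝ, t * hyperbolaFourier Φ L t *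
        (Complex.exp (-(x * Complex.cosh (v + θ * Complex.I))) *
          Complex.exp (Complex.I * t * v)) := integral_integral_swap hprod
    _ = _ := by
        rw [← integral_const_mul]
        congr 1 with v
        rw [mul_left_comm, ← integral_mul_hyperbolaFourier Φ hL v, ← integral_const_mul]
        congr 1 with t
        ring

/-- The factor e^{θt} is compensated by the decay e^{-π|t|/2} of K up to and including |θ| = π/2, so
one integrable bound serves all heights and the boundary limit is dominated. -/
lemma exists_norm_mul_hyperbolaFourier_mul_bessel_le {L : ℝ} (hL : L ≠ 0) {x : ℝ} (hx : 0 < x) :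
    ∃ C : ℝ, ∀ θ t : ℝ, |θ| ≤ Real.pi / 2 → ‖t * hyperbolaFourier Φ L t *
        (2 * Real.exp (θ * t) * (besselMoment t 0 x : ℂ))‖ ≤
      C * (|t| * (1 + |t|) * (1 + t ^ 4)⁻¹) := by
  obtain ⟨C, hC0, hC⟩ := exists_norm_mul_hyperbolaFourier_le Φ hL
  obtain ⟨D, hD0, hD⟩ := exists_abs_besselMoment_le
  refine ⟨C * (2 * D * x ^ (-(1 / 4) : ℝ)), fun θ t hθ => ?_⟩
  have h1 : Real.exp (θ * t) * Real.exp (-(Real.pi / 2 * |t|)) ≤ 1 := by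
    rw [← Real.exp_add, Real.exp_le_one_iff]
    have : θ * t ≤ Real.pi / 2 * |t| := by
      refine (le_abs_self _).trans ?_
      rw [abs_mul]
      gcongr
    linarith
  have h2 : ‖(2 * Real.exp (θ * t) : ℂ)‖ = 2 * Real.exp (θ * t) := by
    rw [norm_mul, Complex.norm_ofNat, Complex.norm_real,
      Real.norm_of_nonneg (Real.exp_pos _).le]
  rw [norm_mul (_ * _), norm_mul (2 * _), h2, Complex.norm_real, Real.norm_eq_abs]
  calc _ ≤ (C * (|t| * (1 + t ^ 4)⁻¹)) * (2 * Real.exp (θ * t) *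
        (D * (1 + |t|) * x ^ (-(1 / 4) : ℝ) * Real.exp (-(Real.pi / 2 * |t|)))) := by
        gcongr
        · exact hC t
        · exact hD t x hx
    _ = C * (2 * D * x ^ (-(1 / 4) : ℝ)) * (|t| * (1 + |t|) * (1 + t ^ 4)⁻¹) *
        (Real.exp (θ * t) * Real.exp (-(Real.pi / 2 * |t|))) := by ring
    _ ≤ _ := mul_le_of_le_one_right (by positivity) h1

lemma aestronglyMeasurable_mul_hyperbolaFourier_mul_bessel (L x θ : ℝ) :
    AEStronglyMeasurable fun t : ℝ => t * hyperbolaFourier Φ L t *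
        (2 * Real.exp (θ * t) * (besselMoment t 0 x : ℂ)) := by
  refine (aestronglyMeasurable_mul_hyperbolaFourier Φ L).mul ?_
  refine AEStronglyMeasurable.mul (Continuous.aestronglyMeasurable (by fun_prop)) ?_
  exact (Complex.measurable_ofReal.comp (stronglyMeasurable_besselMoment.measurable.comp
    (f := fun t : ℝ => (t, x)) (by fun_prop))).aestronglyMeasurable

lemma integrable_mul_hyperbolaFourier_mul_bessel {L : ℝ} (hL : L ≠ 0) {x : ℝ} (hx : 0 < x) {θ : ℝ}
    (hθ : |θ| ≤ Real.pi / 2) : Integrable fun t : ℝ => t * hyperbolaFourier Φ L t *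
        (2 * Real.exp (θ * t) * (besselMoment t 0 x : ℂ)) := by
  obtain ⟨C, hC⟩ := exists_norm_mul_hyperbolaFourier_mul_bessel_le Φ hL hx
  exact (integrable_quadratic_div_quartic.const_mul C).mono'
    (aestronglyMeasurable_mul_hyperbolaFourier_mul_bessel Φ L x θ)
    (Eventually.of_forall fun t => hC θ t hθ)

lemma integral_mul_hyperbolaFourier_mul_bessel_boundary {L : ℝ} (hL : L ≠ 0) {x : ℝ}
    (hx : 0 < x) :
    ∫ t : ℝ, t * hyperbolaFourier Φ L t *
        (2 * Real.exp (Real.pi / 2 * t) * (besselMoment t 0 x : ℂ)) =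
      2 * Real.pi * Complex.I * ∫ v : ℝ, Complex.exp (-(x * (Complex.I * Real.sinh v))) *
        deriv (fun u => Φ (frequency L u)) (-v) := by
  have hpi := Real.pi_pos
  obtain ⟨C, hC⟩ := exists_norm_mul_hyperbolaFourier_mul_bessel_le Φ hL hx
  have hev : ∀ᶠ θ : ℝ in 𝓝[<] (Real.pi / 2), |θ| < Real.pi / 2 := by
    filter_upwards [Ioo_mem_nhdsLT (by linarith : (0 : ℝ) < Real.pi / 2)] with θ hθ
    rw [abs_of_pos hθ.1]
    exact hθ.2
  have hl : Tendsto (fun θ : ℝ => ∫ t : ℝ, t * hyperbolaFourier Φ L t *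
        (2 * Real.exp (θ * t) * (besselMoment t 0 x : ℂ))) (𝓝[<] (Real.pi / 2))
      (𝓝 (∫ t : ℝ, t * hyperbolaFourier Φ L t *
        (2 * Real.exp (Real.pi / 2 * t) * (besselMoment t 0 x : ℂ)))) := by
    refine tendsto_integral_filter_of_dominated_convergence
      (fun t => C * (|t| * (1 + |t|) * (1 + t ^ 4)⁻¹)) ?_ ?_
      (integrable_quadratic_div_quartic.const_mul _) ?_
    · exact Eventually.of_forall fun θ =>
        aestronglyMeasurable_mul_hyperbolaFourier_mul_bessel Φ L x θ
    · filter_upwards [hev] with θ hθ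
      refine Eventually.of_forall fun t => ?_
      exact hC θ t hθ.le
    · refine Eventually.of_forall fun t => ?_
      refine Tendsto.mono_left (Continuous.tendsto ?_ _) nhdsWithin_le_nhds
      fun_prop
  have hr : Tendsto (fun θ : ℝ => 2 * Real.pi * Complex.I * ∫ v : ℝ,
        Complex.exp (-(x * Complex.cosh (v + θ * Complex.I))) *
        deriv (fun u => Φ (frequency L u)) (-v)) (𝓝[<] (Real.pi / 2))
      (𝓝 (2 * Real.pi * Complex.I * ∫ v : ℝ, Complex.exp (-(x * (Complex.I * Real.sinh v))) *
        deriv (fun u => Φ (frequency L u)) (-v))) := by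
    have h1 : Integrable fun v => deriv (fun u => Φ (frequency L u)) (-v) := by
      have := integrable_iteratedDeriv_comp_frequency Φ 1 hL
      rw [iteratedDeriv_one] at this
      exact this.comp_neg
    refine Tendsto.const_mul _ (tendsto_integral_filter_of_dominated_convergence
      (fun v => ‖deriv (fun u => Φ (frequency L u)) (-v)‖) ?_ ?_ h1.norm ?_)
    · exact Eventually.of_forall fun θ => AEStronglyMeasurable.mul
        (Continuous.aestronglyMeasurable (by fun_prop)) h1.aestronglyMeasurable
    · filter_upwards [hev] with θ hθ
      refine Eventually.of_forall fun v => ?_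
      rw [norm_mul]
      refine mul_le_of_le_one_left (norm_nonneg _) ?_
      rw [Complex.norm_exp, Real.exp_le_one_iff, Complex.neg_re, Complex.re_ofReal_mul,
        re_cosh_add_mul_I]
      have := (Real.cos_pos_of_mem_Ioo (abs_lt.1 hθ)).le
      have h2 : 0 ≤ x * (Real.cosh v * Real.cos θ) := by
        have := (Real.cosh_pos v).le
        positivity
      linarith
    · refine Eventually.of_forall fun v => Tendsto.mul_const _ ?_
      have hlim : Complex.I * Real.sinh v = Complex.cosh (v + (Real.pi / 2 : ℝ) * Complex.I) := by
        apply Complex.ext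
        · rw [re_cosh_add_mul_I]; simp
        · rw [im_cosh_add_mul_I]; simp [Complex.sinh_ofReal_re]
      rw [hlim]
      refine Tendsto.mono_left (Continuous.tendsto ?_ _) nhdsWithin_le_nhds
      fun_prop
  refine tendsto_nhds_unique (hl.congr' ?_) hr
  filter_upwards [hev] with θ hθ
  exact integral_mul_hyperbolaFourier_mul_bessel Φ hL hx hθ

lemma integrable_cosh_mul_comp_frequency {L : ℝ} (hL : L ≠ 0) :
    Integrable fun v => (Real.cosh v : ℂ) * Φ (frequency L v) := by
  obtain ⟨C, hC0, hC⟩ := exists_norm_iteratedDeriv_comp_frequency_le Φ 0 2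
  have hl := abs_pos.2 hL
  refine (integrable_inv_cosh.const_mul (C / |L| ^ 2)).mono' ?_ (Eventually.of_forall fun v => ?_)
  · exact Continuous.aestronglyMeasurable
      ((by fun_prop : Continuous fun v : ℝ => (Real.cosh v : ℂ)).mul
        (contDiff_comp_frequency Φ L).continuous)
  · have h := hC L v
    have hv := Real.cosh_pos v
    rw [iteratedDeriv_zero] at h
    rw [norm_mul, Complex.norm_real, Real.norm_of_nonneg hv.le, ← div_eq_mul_inv,
      div_div, le_div_iff₀ (by positivity)]
    calc _ = ‖Φ (frequency L v)‖ * (|L| * Real.cosh v) ^ 2 := by ring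
      _ ≤ ‖Φ (frequency L v)‖ * (1 + |L| * Real.cosh v) ^ 2 := by gcongr; linarith
      _ ≤ C := h

/-- Reflection v ↦ -v, then integration by parts. The resulting cosh v is, up to a constant, the
Jacobian that converts the hyperbola integral into one over a vertical frequency line. -/
lemma integral_exp_sinh_mul_deriv {L : ℝ} (hL : L ≠ 0) (x : ℝ) :
    ∫ v : ℝ, Complex.exp (-(x * (Complex.I * Real.sinh v))) *
        deriv (fun u => Φ (frequency L u)) (-v) =
      -(x * Complex.I) * ∫ v : ℝ, Complex.exp (x * Complex.I * Real.sinh v) *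
        (Real.cosh v * Φ (frequency L v)) := by
  have h0 := integrable_iteratedDeriv_comp_frequency Φ 0 hL
  have h1 := integrable_iteratedDeriv_comp_frequency Φ 1 hL
  rw [iteratedDeriv_zero] at h0
  rw [iteratedDeriv_one] at h1
  have hc := integrable_cosh_mul_comp_frequency Φ hL
  have hn : ∀ v : ℝ, ‖Complex.exp (x * Complex.I * Real.sinh v)‖ = 1 := fun v => by
    rw [mul_right_comm, ← Complex.ofReal_mul, Complex.norm_exp_ofReal_mul_I]
  have hcont : Continuous fun v : ℝ => Complex.exp (x * Complex.I * Real.sinh v) := by fun_prop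
  have hmul : ∀ g : ℝ → ℂ, Integrable g →
      Integrable fun v => Complex.exp (x * Complex.I * Real.sinh v) * g v := fun g hg =>
    hg.norm.mono' (hcont.aestronglyMeasurable.mul hg.aestronglyMeasurable)
      (Eventually.of_forall fun v => by rw [norm_mul, hn, one_mul])
  have hexp : ∀ v : ℝ, HasDerivAt (fun v : ℝ => Complex.exp (x * Complex.I * Real.sinh v))
      (Complex.exp (x * Complex.I * Real.sinh v) * (x * Complex.I * Real.cosh v)) v := fun v =>
    (((Real.hasDerivAt_sinh v).ofReal_comp).const_mul (x * Complex.I)).cexp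
  have hB : ∀ v, HasDerivAt (fun u => Φ (frequency L u))
      (deriv (fun u => Φ (frequency L u)) v) v := fun v =>
    ((contDiff_comp_frequency Φ L).differentiable (by simp) v).hasDerivAt
  have key := integral_mul_deriv_eq_deriv_mul_of_integrable (fun v _ => hexp v) (fun v _ => hB v)
    (hmul _ h1) ?_ (hmul _ h0)
  · rw [← integral_neg_eq_self]
    simp only [neg_neg, Real.sinh_neg, Complex.ofReal_neg, mul_neg]
    rw [← integral_const_mul]
    have h2 : ∀ v : ℝ, (x : ℂ) * (Complex.I * Real.sinh v) = x * Complex.I * Real.sinh v :=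
      fun v => by ring
    simp only [h2]
    rw [key, ← integral_neg]
    congr 1 with v
    ring
  · refine ((hmul _ hc).const_mul (x * Complex.I)).congr (Eventually.of_forall fun v => ?_)
    simp only [Pi.mul_apply]
    ring

lemma integral_exp_sinh_mul_cosh {L : ℝ} (hL : L ≠ 0) (y : ℝ) :
    ∫ v : ℝ, Complex.exp ((|L| * y : ℝ) * Complex.I * Real.sinh v) *
        (Real.cosh v * Φ (frequency L v)) =
      (2 * Real.pi / |L| : ℝ) * ∫ s : ℝ, Complex.exp ((2 * Real.pi * (y * s) : ℝ) * Complex.I) *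
        Φ ⟨-L / (2 * Real.pi), s⟩ := by
  have hl := abs_pos.2 hL
  have hpi := Real.pi_pos
  have ha : 0 < |L| / (2 * Real.pi) := by positivity
  have hd : ∀ v ∈ (univ : Set ℝ), HasDerivWithinAt (fun v => |L| / (2 * Real.pi) * Real.sinh v)
      (|L| / (2 * Real.pi) * Real.cosh v) univ v := fun v _ =>
    ((Real.hasDerivAt_sinh v).const_mul _).hasDerivWithinAt
  have hinj : InjOn (fun v => |L| / (2 * Real.pi) * Real.sinh v) univ :=
    ((mul_right_injective₀ ha.ne').comp Real.sinh_injective).injOn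
  have himg : (fun v => |L| / (2 * Real.pi) * Real.sinh v) '' univ = univ := by
    rw [image_univ]
    exact ((mul_left_surjective₀ ha.ne').comp Real.sinh_surjective).range_eq
  have key := integral_image_eq_integral_abs_deriv_smul MeasurableSet.univ hd hinj
    (fun s : ℝ => Complex.exp ((2 * Real.pi * (y * s) : ℝ) * Complex.I) *
        Φ ⟨-L / (2 * Real.pi), s⟩)
  rw [himg, Measure.restrict_univ] at key
  rw [key, ← integral_const_mul]
  congr 1 with v
  have h1 : frequency L v = ⟨-L / (2 * Real.pi), |L| / (2 * Real.pi) * Real.sinh v⟩ := by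
    rw [frequency, mul_div_right_comm]
  have h2 : ((|L| * y : ℝ) : ℂ) * Complex.I * Real.sinh v =
      ((2 * Real.pi * (y * (|L| / (2 * Real.pi) * Real.sinh v)) : ℝ) : ℂ) * Complex.I := by
    rw [mul_right_comm, ← Complex.ofReal_mul]
    congr 2
    field_simp
  have h3 : (2 * Real.pi / |L|) * (|L| / (2 * Real.pi) * Real.cosh v) = Real.cosh v := by
    field_simp
  rw [abs_of_pos (mul_pos ha (Real.cosh_pos v)), Complex.real_smul, h1, h2]
  nth_rewrite 1 [← h3]
  rw [Complex.ofReal_mul (2 * Real.pi / |L|)]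
  ring

end

/-! ### Integration over the charge and the inversion formula. -/

open Filter Topology
open scoped SchwartzMap FourierTransform

/-- The L-part of the bound for the inversion integrand: one factor |L|^{-1/4} comes from the
transform, the other from K_{it}(|L|τ). -/
lemma integrable_inv_mul_abs_rpow : Integrable fun x : ℝ =>
    (1 + x ^ 2)⁻¹ * |x| ^ (-(1 / 4) : ℝ) * |x| ^ (-(1 / 4) : ℝ) := by
  let g : ℝ → ℝ := (Ioc (0 : ℝ) 1).indicator fun x => x ^ (-(1 / 2) : ℝ)
  have hg0 : ∀ x, 0 ≤ g x := fun x =>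
    indicator_nonneg (fun y hy => Real.rpow_nonneg hy.1.le _) x
  have hg : Integrable g := by
    have h := intervalIntegral.intervalIntegrable_rpow' (a := 0) (b := 1)
      (r := -(1 / 2)) (by norm_num)
    rw [intervalIntegrable_iff_integrableOn_Ioc_of_le zero_le_one] at h
    exact h.integrable_indicator measurableSet_Ioc
  refine ((hg.add hg.comp_neg).add integrable_inv_one_add_sq).mono' ?_ ?_
  · exact Measurable.aestronglyMeasurable (by fun_prop)
  · have h0 : ∀ᵐ x : ℝ, x ≠ 0 := by simp [ae_iff]
    filter_upwards [h0] with x hx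
    have hx' := abs_pos.2 hx
    rw [Real.norm_of_nonneg (by positivity), mul_assoc, ← Real.rpow_add hx']
    norm_num only
    have hi : (1 + x ^ 2)⁻¹ ≤ 1 := inv_le_one_of_one_le₀ (by nlinarith [sq_nonneg x])
    have hi0 : 0 ≤ (1 + x ^ 2)⁻¹ := by positivity
    simp only [Pi.add_apply]
    rcases le_total |x| 1 with h1 | h1
    · have h2 : |x| ^ (-1 / 2 : ℝ) ≤ g x + g (-x) := by
        rcases lt_or_gt_of_ne hx with hneg | hpos
        · have : g (-x) = |x| ^ (-1 / 2 : ℝ) := by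
            rw [abs_of_neg hneg] at h1 ⊢
            rw [show g (-x) = _ from indicator_of_mem (show -x ∈ Ioc (0 : ℝ) 1 from
              ⟨by linarith, h1⟩) _]
            norm_num
          linarith [hg0 x]
        · have : g x = |x| ^ (-1 / 2 : ℝ) := by
            rw [abs_of_pos hpos] at h1 ⊢
            rw [show g x = _ from indicator_of_mem (show x ∈ Ioc (0 : ℝ) 1 from ⟨hpos, h1⟩) _]
            norm_num
          linarith [hg0 (-x)]
      have h3 : (1 + x ^ 2)⁻¹ * |x| ^ (-1 / 2 : ℝ) ≤ |x| ^ (-1 / 2 : ℝ) :=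
        mul_le_of_le_one_left (by positivity) hi
      linarith
    · have h2 : |x| ^ (-1 / 2 : ℝ) ≤ 1 := Real.rpow_le_one_of_one_le_of_nonpos h1 (by norm_num)
      have h3 : (1 + x ^ 2)⁻¹ * |x| ^ (-1 / 2 : ℝ) ≤ (1 + x ^ 2)⁻¹ :=
        mul_le_of_le_one_right hi0 h2
      linarith [hg0 x, hg0 (-x)]

lemma stronglyMeasurable_besselTransform (φ : 𝓢(ℂ, ℂ)) :
    StronglyMeasurable fun q : ℝ × ℝ => besselTransform φ q.1 q.2 := by
  unfold besselTransform
  refine StronglyMeasurable.integral_prod_right (f := fun (q : ℝ × ℝ) (z : ℂ) =>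
    φ z * (Complex.exp (Complex.I * q.1 * z.re) * (besselMoment q.2 0 (|q.1| * z.im) : ℂ))) ?_
  have h1 : Measurable fun r : (ℝ × ℝ) × ℂ => besselMoment r.1.2 0 (|r.1.1| * r.2.im) :=
    stronglyMeasurable_besselMoment.measurable.comp
      (f := fun r : (ℝ × ℝ) × ℂ => (r.1.2, |r.1.1| * r.2.im)) (by fun_prop)
  have h2 : Measurable fun r : (ℝ × ℝ) × ℂ => Complex.exp (Complex.I * r.1.1 * r.2.re) :=
    Continuous.measurable (by fun_prop)
  have h3 : Measurable fun r : (ℝ × ℝ) × ℂ => φ r.2 := φ.continuous.measurable.comp measurable_snd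
  exact (h3.mul (h2.mul (Complex.measurable_ofReal.comp h1))).stronglyMeasurable

/-- Kontorovich–Lebedev inversion along the hyperbola. -/
lemma integral_besselTransform_mul_bessel {φ : 𝓢(ℂ, ℂ)} (h0 : ∀ z : ℂ, z.im ≤ 0 → φ z = 0)
    (hint : Integrable fun z => ‖φ z‖ * z.im ^ (-(1 / 4) : ℝ))
    {L : ℝ} (hL : L ≠ 0) {y : ℝ} (hy : 0 < y) :
    ∫ t : ℝ, besselTransform φ L t * (besselMoment t 0 (|L| * y) : ℂ) *
        ((t * Real.sinh (Real.pi * t) : ℝ) : ℂ) =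
      Real.pi ^ 2 * y * ∫ s : ℝ, Complex.exp ((2 * Real.pi * (y * s) : ℝ) * Complex.I) *
        𝓕 φ ⟨-L / (2 * Real.pi), s⟩ := by
  have hl := abs_pos.2 hL
  have hpi := Real.pi_pos
  have hpi' : (Real.pi : ℂ) ≠ 0 := by exact_mod_cast hpi.ne'
  have hl' : ((|L| : ℝ) : ℂ) ≠ 0 := by exact_mod_cast hl.ne'
  let H : ℝ → ℂ := fun t => t * hyperbolaFourier (𝓕 φ) L t *
    (2 * Real.exp (Real.pi / 2 * t) * (besselMoment t 0 (|L| * y) : ℂ))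
  have hH : Integrable H := integrable_mul_hyperbolaFourier_mul_bessel (𝓕 φ) hL (mul_pos hl hy)
    (θ := Real.pi / 2) (by rw [abs_of_pos (by positivity)])
  have hHint : ∫ t, H t = 4 * (Real.pi ^ 2 * y * ∫ s : ℝ,
      Complex.exp ((2 * Real.pi * (y * s) : ℝ) * Complex.I) * 𝓕 φ ⟨-L / (2 * Real.pi), s⟩) := by
    rw [show ∫ t, H t = _ from integral_mul_hyperbolaFourier_mul_bessel_boundary (𝓕 φ) hL
      (mul_pos hl hy), integral_exp_sinh_mul_deriv (𝓕 φ) hL,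
      integral_exp_sinh_mul_cosh (𝓕 φ) hL y]
    generalize (∫ s : ℝ, Complex.exp ((2 * Real.pi * (y * s) : ℝ) * Complex.I) *
      𝓕 φ ⟨-L / (2 * Real.pi), s⟩) = J
    rw [Complex.ofReal_mul |L| y, Complex.ofReal_div]
    push_cast
    field_simp
    rw [Complex.I_sq]
    ring
  -- `H t` equals 4 t e^{πt} times a function even in t, so `H t + H (-t)` is 8 t sinh(πt) times
  -- that function.
  have hsym : ∀ t : ℝ, besselTransform φ L t * (besselMoment t 0 (|L| * y) : ℂ) *
      ((t * Real.sinh (Real.pi * t) : ℝ) : ℂ) = (1 / 8) * (H t + H (-t)) := by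
    intro t
    have hexp : ∀ s : ℝ, (Real.exp (Real.pi / 2 * s) : ℂ) * Real.exp (Real.pi / 2 * s) =
        Real.exp (Real.pi * s) := fun s => by
      rw [← Complex.ofReal_mul, ← Real.exp_add]
      congr 2
      ring
    have e1 := hexp t
    have e2 := hexp (-t)
    simp only [H]
    rw [← two_mul_exp_mul_besselTransform h0 hL t hint,
      ← two_mul_exp_mul_besselTransform h0 hL (-t) hint, besselTransform_neg, besselMoment_neg,
      Real.sinh_eq]
    rw [mul_neg] at e2 ⊢
    generalize besselTransform φ L t = T at *
    generalize besselMoment t 0 (|L| * y) = K at *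
    push_cast at e1 e2 ⊢
    rw [mul_neg] at e2
    linear_combination (-(1 / 2) * t * T * K) * e1 + ((1 / 2) * t * T * K) * e2
  simp only [hsym]
  rw [integral_const_mul, integral_add hH hH.comp_neg, integral_neg_eq_self H, hHint]
  ring

lemma integral_complex_eq_iterated {F : ℂ → ℂ} (hF : Integrable F) :
    ∫ z, F z = ∫ r : ℝ, ∫ s : ℝ, F ⟨r, s⟩ := by
  have hp := Complex.volume_preserving_equiv_real_prod.symm
  rw [← hp.integral_comp Complex.measurableEquivRealProd.symm.measurableEmbedding]
  exact integral_prod _ ((hp.integrable_comp_emb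
    Complex.measurableEquivRealProd.symm.measurableEmbedding).2 hF)

/-- With r = -L/2π the iterated integral is planar Fourier inversion at the point (ω, y); the factor
2π is the Jacobian. -/
lemma integral_charge_fourier (φ : 𝓢(ℂ, ℂ)) (ω y : ℝ) :
    ∫ L : ℝ, Complex.exp (-Complex.I * L * ω) *
        ∫ s : ℝ, Complex.exp ((2 * Real.pi * (y * s) : ℝ) * Complex.I) *
          𝓕 φ ⟨-L / (2 * Real.pi), s⟩ = 2 * Real.pi * φ ⟨ω, y⟩ := by
  have hpi := Real.pi_pos
  have hpi' : (Real.pi : ℂ) ≠ 0 := by exact_mod_cast hpi.ne'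
  let g : ℝ → ℂ := fun r => ∫ s : ℝ,
    Complex.exp ((2 * Real.pi * (r * ω + s * y) : ℝ) * Complex.I) * 𝓕 φ ⟨r, s⟩
  have h1 : ∀ L : ℝ, Complex.exp (-Complex.I * L * ω) *
        ∫ s : ℝ, Complex.exp ((2 * Real.pi * (y * s) : ℝ) * Complex.I) *
          𝓕 φ ⟨-L / (2 * Real.pi), s⟩ = g (-(2 * Real.pi)⁻¹ * L) := by
    intro L
    simp only [g]
    rw [← integral_const_mul]
    congr 1 with s
    rw [← mul_assoc, ← Complex.exp_add]
    have e1 : -(2 * Real.pi)⁻¹ * L = -L / (2 * Real.pi) := by ring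
    rw [e1]
    congr 2
    push_cast
    field_simp
  simp only [h1]
  rw [Measure.integral_comp_mul_left g, inv_neg, inv_inv, abs_neg, abs_of_pos (by positivity),
    Complex.real_smul]
  have h2 : 𝓕⁻ (𝓕 (φ : ℂ → ℂ)) ⟨ω, y⟩ = φ ⟨ω, y⟩ :=
    φ.integrable.fourierInv_fourier_eq (𝓕 φ).integrable φ.continuous.continuousAt
  rw [← h2, Real.fourierInv_eq']
  have hinner : ∀ z : ℂ, inner ℝ z (⟨ω, y⟩ : ℂ) = z.re * ω + z.im * y := fun z => by
    rw [Complex.inner]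
    simp
    ring
  simp only [hinner, smul_eq_mul]
  rw [integral_complex_eq_iterated]
  · simp only [g]
    push_cast
    rfl
  · refine (𝓕 φ).integrable.norm.mono' ?_ (Eventually.of_forall fun z => ?_)
    · exact Continuous.aestronglyMeasurable ((by fun_prop : Continuous fun z : ℂ =>
        Complex.exp ((2 * Real.pi * (z.re * ω + z.im * y) : ℝ) * Complex.I)).mul
          (𝓕 φ).continuous)
    · rw [norm_mul, Complex.norm_exp_ofReal_mul_I, one_mul]
      rfl

namespace RapidlyDecreasing

lemma integrable_weighted_mul_rpow {f : ℝ × ℝ → ℂ} (hf : RapidlyDecreasing f) (r : ℝ) :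
    Integrable fun z => ‖hf.weighted r z‖ * z.im ^ (-(1 / 4) : ℝ) := by
  refine (hf.weighted (r + -(1 / 4))).integrable.norm.congr (Eventually.of_forall fun z => ?_)
  rcases le_or_gt z.im 0 with hz | hz
  · simp [hf.weighted_of_nonpos _ hz]
  · exact (hf.norm_weighted_mul_rpow r _ hz).symm

/-- The weight -3/2 collects √τ from the eigenfunction and τ^{-2} from the invariant measure. -/
lemma transformIntegrand_eq {f : ℝ × ℝ → ℂ} (hf : RapidlyDecreasing f) (L t : ℝ) {p : ℝ × ℝ}
    (hp : 0 < p.2) :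
    transformIntegrand f L t p = hf.weighted (-(3 / 2)) ⟨p.1, p.2⟩ *
      (Complex.exp (Complex.I * L * p.1) * (besselMoment t 0 (|L| * p.2) : ℂ)) := by
  rw [hf.weighted_of_pos _ (z := ⟨p.1, p.2⟩) hp, transformIntegrand, eigenfn_eq, map_mul,
    Complex.conj_ofReal, ← Complex.exp_conj]
  simp only [map_mul, map_neg, Complex.conj_I, Complex.conj_ofReal, neg_neg]
  have h : Real.sqrt p.2 / p.2 ^ 2 = p.2 ^ (-(3 / 2) : ℝ) := by
    rw [Real.sqrt_eq_rpow, ← Real.rpow_natCast, ← Real.rpow_sub hp]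
    norm_num
  rw [← h]
  push_cast
  ring

lemma transformIntegrand_eqOn {f : ℝ × ℝ → ℂ} (hf : RapidlyDecreasing f) (L t : ℝ) :
    EqOn (transformIntegrand f L t) (fun p => (fun z : ℂ => hf.weighted (-(3 / 2)) z *
      (Complex.exp (Complex.I * L * z.re) * (besselMoment t 0 (|L| * z.im) : ℂ)))
        (Complex.measurableEquivRealProd.symm p)) upperHalf := fun _ hp =>
  hf.transformIntegrand_eq L t hp

lemma integrableOn_transformIntegrand {f : ℝ × ℝ → ℂ} (hf : RapidlyDecreasing f) {L : ℝ}
    (hL : L ≠ 0) (t : ℝ) : IntegrableOn (transformIntegrand f L t) upperHalf := by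
  have h := integrable_besselTransform (fun z hz => hf.weighted_of_nonpos (-(3 / 2)) hz) hL t
    (hf.integrable_weighted_mul_rpow _)
  have h' := (Complex.volume_preserving_equiv_real_prod.symm.integrable_comp_emb
    Complex.measurableEquivRealProd.symm.measurableEmbedding).2 h
  exact h'.integrableOn.congr_fun (hf.transformIntegrand_eqOn L t).symm
    isOpen_upperHalf.measurableSet

lemma transform_eq {f : ℝ × ℝ → ℂ} (hf : RapidlyDecreasing f) (L t : ℝ) :
    transform f L t = besselTransform (hf.weighted (-(3 / 2))) L t := by
  rw [transform, setIntegral_congr_fun isOpen_upperHalf.measurableSet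
    (hf.transformIntegrand_eqOn L t), setIntegral_eq_integral_of_forall_compl_eq_zero]
  · exact Complex.volume_preserving_equiv_real_prod.symm.integral_comp
      Complex.measurableEquivRealProd.symm.measurableEmbedding fun z =>
        hf.weighted (-(3 / 2)) z * (Complex.exp (Complex.I * L * z.re) *
          (besselMoment t 0 (|L| * z.im) : ℂ))
  · intro p hp
    have : hf.weighted (-(3 / 2)) (Complex.measurableEquivRealProd.symm p) = 0 :=
      hf.weighted_of_nonpos _ (not_lt.1 hp)
    simp only [this, zero_mul]

lemma inversionIntegrand_eq {f : ℝ × ℝ → ℂ} (hf : RapidlyDecreasing f) (ω y L t : ℝ) :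
    inversionIntegrand f (ω, y) L t = Complex.exp (-Complex.I * L * ω) * Real.sqrt y *
      (besselTransform (hf.weighted (-(3 / 2))) L t * (besselMoment t 0 (|L| * y) : ℂ) *
        ((t * Real.sinh (Real.pi * t) : ℝ) : ℂ)) := by
  rw [inversionIntegrand, hf.transform_eq, eigenfn_eq]
  push_cast
  ring

/-- The transform and the eigenfunction each contribute e^{-π|t|/2}, which together cancel the
growth of sinh(πt). What is left is a product of an integrable function of L and one of t. -/
lemma integrable_inversionIntegrand {f : ℝ × ℝ → ℂ} (hf : RapidlyDecreasing f) (ω : ℝ) {y : ℝ}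
    (hy : 0 < y) : Integrable fun q : ℝ × ℝ => inversionIntegrand f (ω, y) q.1 q.2 := by
  simp only [hf.inversionIntegrand_eq]
  set φ := hf.weighted (-(3 / 2)) with hφ
  obtain ⟨C, hC0, hC⟩ := exists_norm_besselTransform_le
    (fun z hz => hf.weighted_of_nonpos (-(3 / 2)) hz) (hf.integrable_weighted_mul_rpow _)
  obtain ⟨D, hD0, hD⟩ := exists_abs_besselMoment_le
  have hdom := (integrable_inv_mul_abs_rpow.mul_prod integrable_quadratic_div_quartic).const_mul
    (Real.sqrt y * C * D * y ^ (-(1 / 4) : ℝ))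
  refine hdom.mono' ?_ ?_
  · have h1 : Measurable fun q : ℝ × ℝ => besselMoment q.2 0 (|q.1| * y) :=
      stronglyMeasurable_besselMoment.measurable.comp
        (f := fun q : ℝ × ℝ => (q.2, |q.1| * y)) (by fun_prop)
    have h2 : Measurable fun q : ℝ × ℝ => Complex.exp (-Complex.I * q.1 * ω) * Real.sqrt y :=
      Continuous.measurable (by fun_prop)
    have h3 : Measurable fun q : ℝ × ℝ => ((q.2 * Real.sinh (Real.pi * q.2) : ℝ) : ℂ) :=
      Continuous.measurable (by fun_prop)
    exact (h2.mul (((stronglyMeasurable_besselTransform φ).measurable.mul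
      (Complex.measurable_ofReal.comp h1)).mul h3)).aestronglyMeasurable
  · have hne : ∀ᵐ x : ℝ, x ≠ 0 := by simp [ae_iff]
    filter_upwards [(Measure.quasiMeasurePreserving_fst (μ := (volume : Measure ℝ))
      (ν := (volume : Measure ℝ))).ae hne] with q hq
    obtain ⟨L, t⟩ := q
    have hl : 0 < |L| := abs_pos.2 hq
    have hT := hC L t hq
    have hK := hD t (|L| * y) (mul_pos hl hy)
    rw [Real.mul_rpow hl.le hy.le] at hK
    have hS : |Real.sinh (Real.pi * t)| ≤ Real.exp (Real.pi * |t|) := by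
      rw [Real.abs_sinh, abs_mul, abs_of_pos Real.pi_pos, Real.sinh_eq]
      linarith [Real.exp_pos (Real.pi * |t|), Real.exp_pos (-(Real.pi * |t|))]
    have hE : ‖Complex.exp (-Complex.I * L * ω)‖ = 1 := by
      rw [neg_mul, ← mul_neg, ← Complex.ofReal_neg]
      exact norm_cexp_charge (-L) ω
    have hexp : Real.exp (-(Real.pi / 2 * |t|)) * Real.exp (-(Real.pi / 2 * |t|)) *
        Real.exp (Real.pi * |t|) = 1 := by
      rw [← Real.exp_add, ← Real.exp_add, Real.exp_eq_one_iff]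
      ring
    rw [norm_mul, norm_mul, hE, one_mul, norm_mul, norm_mul, Complex.norm_real, Complex.norm_real,
      Complex.norm_real, Real.norm_of_nonneg (Real.sqrt_nonneg y), Real.norm_eq_abs,
      Real.norm_eq_abs, abs_mul]
    calc _ ≤ Real.sqrt y * ((C * ((1 + L ^ 2)⁻¹ * |L| ^ (-(1 / 4) : ℝ)) * (1 + t ^ 4)⁻¹ *
          Real.exp (-(Real.pi / 2 * |t|))) * (D * (1 + |t|) *
          (|L| ^ (-(1 / 4) : ℝ) * y ^ (-(1 / 4) : ℝ)) * Real.exp (-(Real.pi / 2 * |t|))) *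
          (|t| * Real.exp (Real.pi * |t|))) := by gcongr
      _ = Real.sqrt y * C * D * y ^ (-(1 / 4) : ℝ) *
          (((1 + L ^ 2)⁻¹ * |L| ^ (-(1 / 4) : ℝ) * |L| ^ (-(1 / 4) : ℝ)) *
          (|t| * (1 + |t|) * (1 + t ^ 4)⁻¹)) * (Real.exp (-(Real.pi / 2 * |t|)) *
          Real.exp (-(Real.pi / 2 * |t|)) * Real.exp (Real.pi * |t|)) := by ring
      _ = _ := by rw [hexp, mul_one]

lemma integral_inversionIntegrand {f : ℝ × ℝ → ℂ} (hf : RapidlyDecreasing f) (ω : ℝ) {y : ℝ}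
    (hy : 0 < y) :
    ∫ L : ℝ, ∫ t : ℝ, inversionIntegrand f (ω, y) L t = 2 * (Real.pi : ℂ) ^ 3 * f (ω, y) := by
  have h1 : ∀ᵐ L : ℝ, ∫ t : ℝ, inversionIntegrand f (ω, y) L t =
      (Real.sqrt y * Real.pi ^ 2 * y : ℂ) * (Complex.exp (-Complex.I * L * ω) *
        ∫ s : ℝ, Complex.exp ((2 * Real.pi * (y * s) : ℝ) * Complex.I) *
          𝓕 (hf.weighted (-(3 / 2))) ⟨-L / (2 * Real.pi), s⟩) := by
    have hne : ∀ᵐ x : ℝ, x ≠ 0 := by simp [ae_iff]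
    filter_upwards [hne] with L hL
    simp only [hf.inversionIntegrand_eq]
    rw [integral_const_mul, integral_besselTransform_mul_bessel
      (fun z hz => hf.weighted_of_nonpos (-(3 / 2)) hz) (hf.integrable_weighted_mul_rpow _) hL hy]
    ring
  rw [integral_congr_ae h1, integral_const_mul, integral_charge_fourier,
    hf.weighted_of_pos _ (z := ⟨ω, y⟩) hy]
  -- The √y of the eigenfunction and the y produced by inversion undo the weight -3/2.
  have h2 : Real.sqrt y * y * y ^ (-(3 / 2) : ℝ) = 1 := by
    rw [Real.sqrt_eq_rpow]
    nth_rewrite 2 [← Real.rpow_one y]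
    rw [← Real.rpow_add hy, ← Real.rpow_add hy]
    norm_num
  have h3 : (Real.sqrt y : ℂ) * y * ((y ^ (-(3 / 2) : ℝ) : ℝ) : ℂ) = 1 := by
    exact_mod_cast h2
  linear_combination (2 * (Real.pi : ℂ) ^ 3 * f (ω, y)) * h3

end RapidlyDecreasing

theorem theorem2 (f : ℝ × ℝ → ℂ) (hf : RapidlyDecreasing f) :
    -- the `e_{L,t}` are joint eigenfunctions of the Casimir operator `-τ² (∂_τ² + ∂_ω²)`, with the
    -- eigenvalue `s (1 - s) = 1/4 + t²`, `s = 1/2 + it`, and of the charge operator `i ∂_ω`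
    (∀ L t : ℝ, L ≠ 0 →
      ContDiffOn ℝ 2 (eigenfn L t) upperHalf ∧
      ∀ ω τ : ℝ, 0 < τ →
        -(τ : ℂ) ^ 2 * (iteratedDeriv 2 (fun y : ℝ => eigenfn L t (ω, y)) τ
            + iteratedDeriv 2 (fun x : ℝ => eigenfn L t (x, τ)) ω)
          = (1 / 4 + (t : ℂ) ^ 2) * eigenfn L t (ω, τ) ∧
        Complex.I * deriv (fun x : ℝ => eigenfn L t (x, τ)) ω = L * eigenfn L t (ω, τ)) ∧
    -- the transform is given by an absolutely convergent integral
    (∀ L t : ℝ, L ≠ 0 → IntegrableOn (transformIntegrand f L t) upperHalf) ∧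
    -- the inversion formula, with an absolutely convergent double integral
    ∀ ω τ : ℝ, 0 < τ →
      Integrable (fun q : ℝ × ℝ => inversionIntegrand f (ω, τ) q.1 q.2) ∧
      f (ω, τ) = 1 / (2 * (Real.pi : ℂ) ^ 3) *
        ∫ L : ℝ, ∫ t : ℝ, inversionIntegrand f (ω, τ) L t := by
  refine ⟨fun L t hL => ⟨contDiffOn_eigenfn hL t, fun ω τ hτ =>
    ⟨casimir_eigenfn hL t ω hτ, charge_eigenfn L t ω τ⟩⟩,
    fun L t hL => hf.integrableOn_transformIntegrand hL t,
    fun ω τ hτ => ⟨hf.integrable_inversionIntegrand ω hτ, ?_⟩⟩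
  have hpi : (Real.pi : ℂ) ≠ 0 := by exact_mod_cast Real.pi_ne_zero
  rw [hf.integral_inversionIntegrand ω hτ]
  field_simp
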